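/- **Setting.** Let $\Omega\subset\mathbb R^N$ be a bounded Lipschitz domain, $n\in\mathbb N$; repeated indices $\alpha,\beta=1,\dots,n$ and $i,j=1,\dots,N$ are summed. Let $a^{\alpha\beta}_{ij}(\varepsilon,\cdot)\in L^\infty(\Omega)$ ($\varepsilon>0$) be bounded uniformly in $\varepsilon$ and satisfy, for some $c>0$, the Legendre condition $a^{\alpha\beta}_{ij}(\varepsilon,x)v^\alpha_iv^\beta_j\ge c\,v^\alpha_iv^\alpha_i$ for all $\varepsilon>0$, almost all $x\in\Omega$ and all $v\in\mathbb R^{nN}$. Write $W:=W^{1,2}_0(\Omega;\mathbb R^n)$, $W^*:=W^{-1,2}(\Omega;\mathbb R^n)$ for its dual, and $C:=C(\overline\Omega;\mathbb R^n)$ with $\|u\|_\infty=\sum_\alpha\sup|u^\alpha|$. Define $A_\varepsilon:W\to W^*$ and $D$ by $$\langle A_\varepsilon u,\varphi\rangle=\int_\Omega a^{\alpha\beta}_{ij}(\varepsilon,x)\,\partial_{x_j}u^\beta\,\partial_{x_i}\varphi^\alpha\,dx,\qquad \langle Dg,\varphi\rangle=\int_\Omega g^\alpha_i\,\partial_{x_i}\varphi^\alpha\,dx\qquad(\varphi\in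 W),$$ and $\hat A$ in the same way from $\hat a^{\alpha\beta}_{ij}\in L^\infty(\Omega)$. Suppose that $a(\varepsilon,\cdot)$ H-converges to $\hat a$ for $\varepsilon\to0$: for every $\phi\in W^*$ and the corresponding solutions of $A_\varepsilon u_\varepsilon=\hat A\hat u=\phi$, one has $u_\varepsilon\rightharpoonup\hat u$ weakly in $W$ and $a^{\alpha\beta}_{ij}(\varepsilon,\cdot)\partial_{x_j}u^\beta_\varepsilon\rightharpoonup\hat a^{\alpha\beta}_{ij}\partial_{x_j}\hat u^\beta$ weakly in $L^2(\Omega)$. Let $p_0>N$, $p_0\ge2$, and let $f^\alpha_i:\Omega\times\mathbb R^n\to\mathbb R$ be such that $F(u):=[f^\alpha_i(\cdot,u(\cdot))]$ defines a $C^1$-map $F:C\to L^{p_0}(\Omega;\mathbb R^{nN})$. Let $u_0\in W\cap C$ satisfy $\hat Au_0+DF(u_0)=0$, and let $u=0$ be the only $u\in W\cap C$ with $\hat Au+DF'(u_0)u=0$. Let $U,V$ be real Banach spaces such that $U$ is continuously embedded into $W$ and compactly into $C$, and $V$ is continuously embedded into $W^*$. Suppose that $\hat A$ and $A_\varepsilon$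 ($\varepsilon>0$) map $U$ boundedly into $V$, that $D$ maps $L^{p_0}(\Omega;\mathbb R^{nN})$ boundedly into $V$, that each $A_\varepsilon:U\to V$ is bijective, and that $\sup_{\varepsilon>0}\|A_\varepsilon^{-1}\|_{\mathcal L(V;U)}<\infty$. Put $\bar u_\varepsilon:=-A_\varepsilon^{-1}DF(u_0)\in U$. **Theorem.** There is $\varepsilon_0>0$ such that $A_\varepsilon+DF'(u_0):U\to V$ is bijective for all $\varepsilon\in(0,\varepsilon_0]$, with inverses bounded in $\mathcal L(V;U)$ uniformly in $\varepsilon$. For these $\varepsilon$ let $$G_\varepsilon:U\to U,\qquad G_\varepsilon(u):=u-(A_\varepsilon+DF'(u_0))^{-1}(A_\varepsilon u+DF(u)).$$ There exist $r_0>0$ and $\varepsilon_1\in(0,\varepsilon_0]$ such that for all $\varepsilon\in(0,\varepsilon_1]$ the map $G_\varepsilon$ has exactly one fixed point $u_\varepsilon$ in the ball $\{u\in U:\|u-\bar u_\varepsilon\|_U\le r_0\}$. Moreover, $$\|u_\varepsilon-u_0\|_\infty=O\big(\|\bar u_\varepsilon-u_0\|_\infty+\|A_\varepsilon\bar u_\varepsilon+DF(\bar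 u_\varepsilon)\|_V\big)\quad\text{for }\varepsilon\to0.$$ Finally, there exist $\delta>0$ and $\varepsilon_2\in(0,\varepsilon_1]$ such that for all $\varepsilon\in(0,\varepsilon_2]$ the function $u_\varepsilon$ is the only fixed point $u\in U$ of $G_\varepsilon$ with $\|u-u_0\|_\infty<\delta$, and also the only $u\in W\cap C$ with $A_\varepsilon u+DF(u)=0$ and $\|u-u_0\|_\infty<\delta$. -/

import Mathlib

open MeasureTheory Filter Topology Set
open scoped ENNReal ContDiff BoundedContinuousFunction

noncomputable section

namespace Homog

/-! ### Function spaces -/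

/-- The space `ℝ^N` with its Euclidean norm. -/
abbrev Sp (N : ℕ) : Type := EuclideanSpace ℝ (Fin N)

/-- The space `ℝ^{nN}`; a vector `g` has the components `g (α, i)`, `α ≤ n`, `i ≤ N`. -/
abbrev Gr (n N : ℕ) : Type := EuclideanSpace ℝ (Fin n × Fin N)

/-- `Ω` is a bounded Lipschitz domain: open, connected, bounded, and near each of its boundary
points it is, for some unit vector `e`, the set of points `y` lying above the graph of a Lipschitz
function of the components of `y` orthogonal to `e`. -/
structure IsBoundedLipschitzDomain {N : ℕ} (Ω : Set (Sp N)) : Prop where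
  isOpen : IsOpen Ω
  isConnected : IsConnected Ω
  isBounded : Bornology.IsBounded Ω
  lipschitz : ∀ x ∈ frontier Ω, ∃ (e : Sp N) (g : Sp N → ℝ) (K : NNReal) (r : ℝ),
    ‖e‖ = 1 ∧ LipschitzWith K g ∧ (∀ (y : Sp N) (t : ℝ), g (y + t • e) = g y) ∧ 0 < r ∧
      ∀ y ∈ Metric.ball x r, (y ∈ Ω ↔ g y < inner ℝ y e)

/-- The Lebesgue space `L^p(Ω; ℝ^n)`. -/
abbrev LpVec {N : ℕ} (Ω : Set (Sp N)) (n : ℕ) (p : ℝ≥0∞) : Type :=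
  Lp (Sp n) p (volume.restrict Ω)

/-- The Lebesgue space `L^p(Ω; ℝ^{nN})`. -/
abbrev LpGr {N : ℕ} (Ω : Set (Sp N)) (n : ℕ) (p : ℝ≥0∞) : Type :=
  Lp (Gr n N) p (volume.restrict Ω)

/-- The Jacobian of a map `ψ : ℝ^N → ℝ^n`, as an element of `ℝ^{nN}`:
its components are `∂_{x_i} ψ^α (x)`. -/
def jac {n N : ℕ} (ψ : Sp N → Sp n) (x : Sp N) : Gr n N :=
  WithLp.toLp 2 fun k => fderiv ℝ ψ x (EuclideanSpace.single k.2 1) k.1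

/-- The pairs `(ψ, ∇ψ)`, `ψ` a smooth map with compact support in `Ω`, as elements of
`L^2(Ω; ℝ^n) × L^2(Ω; ℝ^{nN})` with the norm `(‖u‖^2 + ‖g‖^2)^{1/2}`. -/
def testPairs {N : ℕ} (Ω : Set (Sp N)) (n : ℕ) :
    Submodule ℝ (WithLp 2 (LpVec Ω n 2 × LpGr Ω n 2)) where
  carrier := {z | ∃ ψ : Sp N → Sp n, ContDiff ℝ ∞ ψ ∧ HasCompactSupport ψ ∧ tsupport ψ ⊆ Ω ∧
    z.fst =ᵐ[volume.restrict Ω] ψ ∧ z.snd =ᵐ[volume.restrict Ω] jac ψ}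
  zero_mem' := by
    refine ⟨0, contDiff_const, HasCompactSupport.zero, by simp [tsupport], ?_, ?_⟩
    · exact Lp.coeFn_zero _ _ _
    · refine (Lp.coeFn_zero _ _ _).trans (Eventually.of_forall fun x => ?_)
      ext k
      simp [jac]
  add_mem' := by
    rintro z w ⟨ψ, h1, h2, h3, h4, h5⟩ ⟨χ, k1, k2, k3, k4, k5⟩
    refine ⟨ψ + χ, h1.add k1, h2.add k2,
      (tsupport_add ψ χ).trans (union_subset h3 k3), ?_, ?_⟩
    · exact (Lp.coeFn_add _ _).trans (h4.add k4)
    · refine (Lp.coeFn_add _ _).trans ((h5.add k5).trans (Eventually.of_forall fun x => ?_))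
      ext k
      have := fderiv_add (h1.differentiable (by simp) x) (k1.differentiable (by simp) x)
      simp [jac, this]
  smul_mem' := by
    rintro c z ⟨ψ, h1, h2, h3, h4, h5⟩
    refine ⟨c • ψ, contDiff_const.smul h1, h2.mono' ?_, (closure_mono ?_).trans h3, ?_, ?_⟩
    · exact (Function.support_const_smul_subset c ψ).trans subset_closure
    · exact Function.support_const_smul_subset c ψ
    · exact (Lp.coeFn_smul _ _).trans (h4.const_smul c)
    · refine (Lp.coeFn_smul _ _).trans
        ((h5.const_smul c).trans (Eventually.of_forall fun x => ?_))
      ext k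
      have := fderiv_const_smul (h1.differentiable (by simp) x) c
      simp [jac, this]

/-- The Sobolev space `W_0^{1,2}(Ω; ℝ^n)`: the closure of the smooth maps with compact support in
`Ω` with respect to the norm of `W^{1,2}(Ω; ℝ^n)`. An element is recorded as the pair
`(u, ∇u) ∈ L^2 × L^2` of a function and its weak gradient. -/
abbrev W012 {N : ℕ} (Ω : Set (Sp N)) (n : ℕ) : Type :=
  ↥(testPairs Ω n).topologicalClosure

/-- The space `W^{-1,2}(Ω; ℝ^n)`: the dual of `W_0^{1,2}(Ω; ℝ^n)` with the dual norm. -/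
abbrev Wneg {N : ℕ} (Ω : Set (Sp N)) (n : ℕ) : Type := StrongDual ℝ (W012 Ω n)

/-- The function belonging to an element of `W_0^{1,2}(Ω; ℝ^n)`. -/
def W012.fn {N n : ℕ} {Ω : Set (Sp N)} (u : W012 Ω n) : LpVec Ω n 2 := u.1.fst

/-- The weak gradient, as a bounded linear map `W_0^{1,2}(Ω; ℝ^n) → L^2(Ω; ℝ^{nN})`. -/
def grad {N : ℕ} (Ω : Set (Sp N)) (n : ℕ) : W012 Ω n →L[ℝ] LpGr Ω n 2 :=
  (WithLp.sndL 2 ℝ (LpVec Ω n 2) (LpGr Ω n 2)) ∘L (testPairs Ω n).topologicalClosure.subtypeL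

/-- The space `C(closure Ω; ℝ^n)` with the maximum norm (for bounded `Ω` all continuous functions
on `closure Ω` are bounded). -/
abbrev CBar {N : ℕ} (Ω : Set (Sp N)) (n : ℕ) : Type := ↥(closure Ω) →ᵇ Sp n

/-- The function on `ℝ^N` that agrees with `v` on `closure Ω` and vanishes elsewhere. -/
def ext0 {N n : ℕ} {Ω : Set (Sp N)} (v : CBar Ω n) : Sp N → Sp n :=
  Function.extend Subtype.val v 0

/-- The norm `‖v‖_∞ = ∑_α sup |v^α|` of a function `v ∈ C(closure Ω; ℝ^n)`. -/
def supNorm {N n : ℕ} {Ω : Set (Sp N)} (v : CBar Ω n) : ℝ :=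
  ∑ α : Fin n, ⨆ x : ↥(closure Ω), |v x α|

theorem ext0_apply {N n : ℕ} {Ω : Set (Sp N)} (v : CBar Ω n) (x : ↥(closure Ω)) :
    ext0 v x = v x :=
  Subtype.val_injective.extend_apply _ _ _

theorem ext0_add {N n : ℕ} {Ω : Set (Sp N)} (v w : CBar Ω n) :
    ext0 (v + w) = ext0 v + ext0 w := by
  funext x
  by_cases hx : x ∈ closure Ω
  · have e := fun v : CBar Ω n => ext0_apply v ⟨x, hx⟩
    simp only at e
    simp [e]
  · have e : ∀ v : CBar Ω n, ext0 v x = 0 := fun v =>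
      Function.extend_apply' _ _ _ (by rintro ⟨y, rfl⟩; exact hx y.2)
    simp [e]

theorem ext0_smul {N n : ℕ} {Ω : Set (Sp N)} (c : ℝ) (v : CBar Ω n) :
    ext0 (c • v) = c • ext0 v := by
  funext x
  by_cases hx : x ∈ closure Ω
  · have e := fun v : CBar Ω n => ext0_apply v ⟨x, hx⟩
    simp only at e
    simp [e]
  · have e : ∀ v : CBar Ω n, ext0 v x = 0 := fun v =>
      Function.extend_apply' _ _ _ (by rintro ⟨y, rfl⟩; exact hx y.2)
    simp [e]

/-- The intersection `W_0^{1,2}(Ω; ℝ^n) ∩ C(closure Ω; ℝ^n)`: the pairs of an element of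
`W_0^{1,2}` and an element of `C(closure Ω)` that agree almost everywhere in `Ω`, with the maximum
of the two norms. -/
def W0C {N : ℕ} (Ω : Set (Sp N)) (n : ℕ) : Submodule ℝ (W012 Ω n × CBar Ω n) where
  carrier := {z | z.1.fn =ᵐ[volume.restrict Ω] ext0 z.2}
  zero_mem' := by
    refine (Lp.coeFn_zero _ _ _).trans (Eventually.of_forall fun x => ?_)
    have h : ext0 (0 : CBar Ω n) = 0 := by
      simpa using ext0_add (0 : CBar Ω n) 0
    change (0 : Sp n) = ext0 (0 : CBar Ω n) x
    rw [h]
    rfl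
  add_mem' := by
    intro z w hz hw
    change _ =ᵐ[_] ext0 (z.2 + w.2)
    rw [ext0_add]
    exact (Lp.coeFn_add _ _).trans (EventuallyEq.add hz hw)
  smul_mem' := by
    intro c z hz
    change _ =ᵐ[_] ext0 (c • z.2)
    rw [ext0_smul]
    exact (Lp.coeFn_smul _ _).trans (EventuallyEq.const_smul (show z.1.fn =ᵐ[_] ext0 z.2 from hz) c)

/-- The inclusion of `W_0^{1,2} ∩ C` into `W_0^{1,2}`. -/
def toW {N : ℕ} (Ω : Set (Sp N)) (n : ℕ) : W0C Ω n →L[ℝ] W012 Ω n :=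
  (ContinuousLinearMap.fst ℝ (W012 Ω n) (CBar Ω n)) ∘L (W0C Ω n).subtypeL

/-- The inclusion of `W_0^{1,2} ∩ C` into `C(closure Ω)`. -/
def toC {N : ℕ} (Ω : Set (Sp N)) (n : ℕ) : W0C Ω n →L[ℝ] CBar Ω n :=
  (ContinuousLinearMap.snd ℝ (W012 Ω n) (CBar Ω n)) ∘L (W0C Ω n).subtypeL

/-! ### Diffusion tensors, the operators `A` and `D`, H-convergence -/

/-- Diffusion tensors: `a α β i j` is the coefficient `a_{ij}^{αβ} ∈ L^∞(Ω)`. -/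
abbrev Tensor {N : ℕ} (Ω : Set (Sp N)) (n : ℕ) : Type :=
  Fin n → Fin n → Fin N → Fin N → Lp ℝ ∞ (volume.restrict Ω)

/-- The Legendre condition with the constant `c`. -/
def IsLegendre {N n : ℕ} {Ω : Set (Sp N)} (c : ℝ) (a : Tensor Ω n) : Prop :=
  ∀ᵐ x ∂(volume.restrict Ω), ∀ v : Gr n N,
    c * ∑ α, ∑ i, v (α, i) ^ 2 ≤ ∑ α, ∑ β, ∑ i, ∑ j, a α β i j x * v (α, i) * v (β, j)

/-- The component `g ↦ g (α, i)`, as a map `L^2(Ω; ℝ^{nN}) → L^2(Ω)`. -/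
def comp {N : ℕ} (Ω : Set (Sp N)) (n : ℕ) (k : Fin n × Fin N) :
    LpGr Ω n 2 →L[ℝ] Lp ℝ 2 (volume.restrict Ω) :=
  (EuclideanSpace.proj k : Gr n N →L[ℝ] ℝ).compLpL 2 (volume.restrict Ω)

/-- The components `∑_{β,j} a_{ij}^{αβ} ∂_{x_j} u^β ∈ L^2(Ω)` of the flux of `u`, as a bounded
linear function of `u ∈ W_0^{1,2}(Ω; ℝ^n)`. -/
def flux {N n : ℕ} {Ω : Set (Sp N)} (a : Tensor Ω n) (α : Fin n) (i : Fin N) :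
    W012 Ω n →L[ℝ] Lp ℝ 2 (volume.restrict Ω) :=
  ∑ β, ∑ j, ((ContinuousLinearMap.mul ℝ ℝ).holderL (volume.restrict Ω) ∞ 2 2 (a α β i j)) ∘L
    (comp Ω n (β, j)) ∘L (grad Ω n)

/-- The bounded linear operator `A : W_0^{1,2}(Ω; ℝ^n) → W^{-1,2}(Ω; ℝ^n)` of the diffusion tensor
`a`, `⟨A u, φ⟩ = ∫_Ω a_{ij}^{αβ} ∂_{x_j} u^β ∂_{x_i} φ^α dx`, see `opA_apply`. -/
def opA {N n : ℕ} {Ω : Set (Sp N)} (a : Tensor Ω n) : W012 Ω n →L[ℝ] Wneg Ω n :=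
  ∑ α, ∑ i, (innerSL ℝ (E := Lp ℝ 2 (volume.restrict Ω))).bilinearComp (flux a α i)
    ((comp Ω n (α, i)) ∘L (grad Ω n))

theorem comp_ae {N n : ℕ} {Ω : Set (Sp N)} (k : Fin n × Fin N) (g : LpGr Ω n 2) :
    comp Ω n k g =ᵐ[volume.restrict Ω] fun x => g x k :=
  ContinuousLinearMap.coeFn_compLp _ _

theorem flux_ae {N n : ℕ} {Ω : Set (Sp N)} (a : Tensor Ω n) (α : Fin n) (i : Fin N)
    (u : W012 Ω n) :
    flux a α i u =ᵐ[volume.restrict Ω]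
      fun x => ∑ β, ∑ j, a α β i j x * grad Ω n u x (β, j) := by
  have h : ∀ β j, ((ContinuousLinearMap.mul ℝ ℝ).holderL (volume.restrict Ω) ∞ 2 2 (a α β i j)
      (comp Ω n (β, j) (grad Ω n u)) : Lp ℝ 2 (volume.restrict Ω)) =ᵐ[volume.restrict Ω]
      fun x => a α β i j x * grad Ω n u x (β, j) := by
    intro β j
    refine ((ContinuousLinearMap.mul ℝ ℝ).coeFn_holder (r := 2) (a α β i j)
      (comp Ω n (β, j) (grad Ω n u))).trans ?_
    filter_upwards [comp_ae (β, j) (grad Ω n u)] with x hx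
    simp [hx]
  simp only [flux, sum_apply, ContinuousLinearMap.comp_apply]
  refine (Lp.coeFn_finsetSum _ _).trans ?_
  have h' := fun β => (Lp.coeFn_finsetSum Finset.univ fun j =>
    ((ContinuousLinearMap.mul ℝ ℝ).holderL (volume.restrict Ω) ∞ 2 2 (a α β i j)
      (comp Ω n (β, j) (grad Ω n u)) : Lp ℝ 2 (volume.restrict Ω)))
  filter_upwards [ae_all_iff.2 fun β => ae_all_iff.2 fun j => h β j, ae_all_iff.2 h']
    with x hx hx'
  rw [Finset.sum_apply]
  refine Finset.sum_congr rfl fun β _ => (hx' β).trans ?_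
  rw [Finset.sum_apply]
  exact Finset.sum_congr rfl fun j _ => hx β j

theorem opA_apply {N n : ℕ} {Ω : Set (Sp N)} (a : Tensor Ω n) (u φ : W012 Ω n) :
    opA a u φ = ∑ α, ∑ i, ∫ x in Ω,
      (∑ β, ∑ j, a α β i j x * grad Ω n u x (β, j)) * grad Ω n φ x (α, i) := by
  simp only [opA, sum_apply, ContinuousLinearMap.bilinearComp_apply,
    ContinuousLinearMap.comp_apply, innerSL_apply_apply, L2.inner_def]
  refine Finset.sum_congr rfl fun α _ => Finset.sum_congr rfl fun i _ => integral_congr_ae ?_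
  filter_upwards [flux_ae a α i u, comp_ae (α, i) (grad Ω n φ)] with x h1 h2
  simp [h1, h2, mul_comm]

/-- The pairing `⟨D g, φ⟩ = ∫_Ω g_i^α ∂_{x_i} φ^α dx` defining the operator `D` with values in
`W^{-1,2}(Ω; ℝ^n)`. -/
def pairD {N n : ℕ} {Ω : Set (Sp N)} (g : Sp N → Gr n N) (φ : W012 Ω n) : ℝ :=
  ∫ x in Ω, ∑ α, ∑ i, g x (α, i) * grad Ω n φ x (α, i)

/-- H-convergence of the diffusion tensors `a ε` for `ε → 0`, `ε > 0`, to `ahat`: for all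
`φ ∈ W^{-1,2}` there is a solution `uhat` of `Ahat uhat = φ` such that the solutions `u ε` of
`A_ε (u ε) = φ` and their fluxes converge weakly to `uhat` in `W_0^{1,2}` and to the flux of `uhat`
in `L^2`, respectively. -/
def HConverges {N n : ℕ} {Ω : Set (Sp N)} (a : ℝ → Tensor Ω n) (ahat : Tensor Ω n) : Prop :=
  ∀ φ : Wneg Ω n, ∃ uhat : W012 Ω n, opA ahat uhat = φ ∧
    ∀ u : ℝ → W012 Ω n, (∀ ε > 0, opA (a ε) (u ε) = φ) →
      (∀ ψ : Wneg Ω n, Tendsto (fun ε => ψ (u ε)) (𝓝[>] 0) (𝓝 (ψ uhat))) ∧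
      ∀ (α : Fin n) (i : Fin N) (ψ : StrongDual ℝ (Lp ℝ 2 (volume.restrict Ω))),
        Tendsto (fun ε => ψ (flux (a ε) α i (u ε))) (𝓝[>] 0) (𝓝 (ψ (flux ahat α i uhat)))

/-! ### Superposition operators and weak solutions -/

/-- The function `x ↦ [f_i^α(x, v(x))]`. -/
def superpos {N n : ℕ} {Ω : Set (Sp N)} (f : Fin n → Fin N → Sp N → Sp n → ℝ) (v : CBar Ω n)
    (x : Sp N) : Gr n N :=
  WithLp.toLp 2 fun k => f k.1 k.2 x (ext0 v x)

/-- The superposition operator `F : C(closure Ω; ℝ^n) → L^p(Ω; ℝ^{nN})` generated by `f`. -/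
def opF {N n : ℕ} {Ω : Set (Sp N)} (f : Fin n → Fin N → Sp N → Sp n → ℝ) (p : ℝ≥0∞)
    (hf : ∀ v : CBar Ω n, MemLp (superpos f v) p (volume.restrict Ω)) (v : CBar Ω n) :
    LpGr Ω n p :=
  (hf v).toLp

/-- `u ∈ W_0^{1,2} ∩ C` is a weak solution of the Dirichlet problem
`∂_{x_i} (a_{ij}^{αβ} ∂_{x_j} u^β + f_i^α(x, u)) = 0` in `Ω`, `u = 0` on `∂Ω`. -/
def IsWeakSolution {N n : ℕ} {Ω : Set (Sp N)} (a : Tensor Ω n)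
    (f : Fin n → Fin N → Sp N → Sp n → ℝ) (u : W0C Ω n) : Prop :=
  ∀ φ : W012 Ω n, ∫ x in Ω, ∑ α, ∑ i,
    ((∑ β, ∑ j, a α β i j x * grad Ω n (toW Ω n u) x (β, j)) +
      f α i x (ext0 (toC Ω n u) x)) * grad Ω n φ x (α, i) = 0

/-! ### The fixed point problem -/

/-- The operator `A + D F'(u₀) : U → V`, where `dF` is `F'(u₀)` and `jC` the embedding of `U` into
`C(closure Ω)`. -/
def linOp {N n : ℕ} {Ω : Set (Sp N)} {p : ℝ≥0∞} [Fact (1 ≤ p)] {U V : Type*}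
    [NormedAddCommGroup U] [NormedSpace ℝ U] [NormedAddCommGroup V] [NormedSpace ℝ V]
    (A : U →L[ℝ] V) (D : LpGr Ω n p →L[ℝ] V) (dF : CBar Ω n →L[ℝ] LpGr Ω n p)
    (jC : U →L[ℝ] CBar Ω n) : U →L[ℝ] V :=
  A + D ∘L dF ∘L jC

/-- The map `G(u) = u - (A + D F'(u₀))⁻¹ (A u + D F(u))` of `U` into itself, for bijective
`A + D F'(u₀)`. -/
def fixMap {N n : ℕ} {Ω : Set (Sp N)} {p : ℝ≥0∞} [Fact (1 ≤ p)] {U V : Type*}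
    [NormedAddCommGroup U] [NormedSpace ℝ U] [NormedAddCommGroup V] [NormedSpace ℝ V]
    (A : U →L[ℝ] V) (D : LpGr Ω n p →L[ℝ] V) (F : CBar Ω n → LpGr Ω n p) (u₀ : CBar Ω n)
    (jC : U →L[ℝ] CBar Ω n) (u : U) : U :=
  u - (linOp A D (fderiv ℝ F u₀) jC).inverse (A u + D (F (jC u)))

/-- The approximate solution `-A⁻¹ D F(u₀) ∈ U`, for bijective `A`. -/
def approxSol {N n : ℕ} {Ω : Set (Sp N)} {p : ℝ≥0∞} [Fact (1 ≤ p)] {U V : Type*}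
    [NormedAddCommGroup U] [NormedSpace ℝ U] [NormedAddCommGroup V] [NormedSpace ℝ V]
    (A : U →L[ℝ] V) (D : LpGr Ω n p →L[ℝ] V) (F : CBar Ω n → LpGr Ω n p) (u₀ : CBar Ω n) : U :=
  -A.inverse (D (F u₀))

end Homog

end

open Homog

/-! The map `G_ε` is a Newton map whose derivative is frozen at `u₀`. With `T_ε = A_ε + D F'(u₀)`,
the operator `A_ε` cancels in differences: `G_ε u - G_ε v = -T_ε⁻¹ D (F u - F v - F'(u₀)(u - v))`.
Strict differentiability of `F` at `u₀` in `C` makes this a contraction with factor 1/2 wherever `u`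
and `v` are uniformly close to `u₀`, provided that `T_ε⁻¹` is bounded uniformly in `ε`. Closeness in
`C` suffices, although `A_ε` need not converge in operator norm.

H-convergence enters twice, in the strengthened form that strong convergence of the right-hand sides
`A_ε w_ε → Â u` in `W*` forces `w_ε ⇀ u` in `W`. First, if `T_ε` had no uniform lower bound,
normalized `w_k` with `T w_k → 0` would, by compactness of `U → C`, yield a limit solving the
homogenized linearized equation; it vanishes by nondegeneracy, so `A w_k → 0`, against the uniform
bound on `A_ε⁻¹` (`exists_lower_bound_linearization`). Bijectivity is then the Fredholm alternative.
Second, the same compactness argument gives `ū_ε → u₀` uniformly (`tendsto_solution_sup`), so the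
residual `D (F ū_ε - F u₀)` tends to zero.

The contraction principle (`exists_newton_fixedPoints`) now gives the fixed point, with its distance
to `ū_ε` controlled by the residual. Weak solutions in `W ∩ C` lie in `U`, since `A_ε` is bijective
on `U` and injective on `W`, so the uniqueness extends to them. -/

set_option maxSynthPendingDepth 4

namespace Homog

/-! ### Coercive operators on a Hilbert space and weak limits of solutions -/

section Hilbert

variable {W : Type*} [NormedAddCommGroup W] [InnerProductSpace ℝ W]

theorem coercive_le_norm {B : W →L[ℝ] StrongDual ℝ W} {c : ℝ} (hB : ∀ u, c * ‖u‖ ^ 2 ≤ B u u)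
    (u : W) : c * ‖u‖ ≤ ‖B u‖ := by
  rcases eq_or_lt_of_le (norm_nonneg u) with h | h
  · rw [← h, mul_zero]; exact norm_nonneg _
  · refine le_of_mul_le_mul_right ?_ h
    calc c * ‖u‖ * ‖u‖ = c * ‖u‖ ^ 2 := by ring
      _ ≤ B u u := hB u
      _ ≤ ‖B u u‖ := Real.le_norm_self _
      _ ≤ ‖B u‖ * ‖u‖ := (B u).le_opNorm u

theorem coercive_injective {B : W →L[ℝ] StrongDual ℝ W} {c : ℝ} (hc : 0 < c)
    (hB : ∀ u, c * ‖u‖ ^ 2 ≤ B u u) : Function.Injective B := by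
  refine (injective_iff_map_eq_zero B).2 fun u hu => ?_
  have := coercive_le_norm hB u
  rw [hu, norm_zero] at this
  exact norm_le_zero_iff.1 (nonpos_of_mul_nonpos_right this hc)

/-- Lax–Milgram, composed with the Riesz isomorphism. -/
theorem coercive_exists_rightInverse [CompleteSpace W] {B : W →L[ℝ] StrongDual ℝ W} {c : ℝ}
    (hc : 0 < c) (hB : ∀ u, c * ‖u‖ ^ 2 ≤ B u u) :
    ∃ R : StrongDual ℝ W →L[ℝ] W, ∀ φ, B (R φ) = φ := by
  have hco : IsCoercive B := ⟨c, hc, fun u => by simpa [sq, mul_assoc] using hB u⟩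
  let J : StrongDual ℝ W →L[ℝ] W :=
    { toFun := (InnerProductSpace.toDual ℝ W).symm
      map_add' := map_add _
      map_smul' := fun t φ => by simp
      cont := (InnerProductSpace.toDual ℝ W).symm.continuous }
  have hJ : ∀ φ w, inner ℝ (J φ) w = φ w := fun φ w => InnerProductSpace.toDual_symm_apply
  refine ⟨(hco.continuousLinearEquivOfBilin.symm : W →L[ℝ] W) ∘L J, fun φ => ?_⟩
  ext w
  rw [← hco.continuousLinearEquivOfBilin_apply]
  simp [hJ]

/-- If the solutions of `B ε u = φ` converge weakly, for every `φ`, to a solution of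
`Bhat u = φ`, then conversely every `u` is the weak limit of the solutions for the right-hand
side `Bhat u`; in particular `Bhat` is injective. -/
theorem tendsto_solution_of_coercive [CompleteSpace W] {B R : ℝ → _}
    {Bhat : W →L[ℝ] StrongDual ℝ W} {c M : ℝ} (hc : 0 < c)
    (hB : ∀ ε > 0, ∀ u, c * ‖u‖ ^ 2 ≤ (B ε : W →L[ℝ] StrongDual ℝ W) u u)
    (hM : ∀ ε > 0, ‖B ε‖ ≤ M)
    (hR : ∀ ε > 0, ∀ φ, B ε ((R ε : StrongDual ℝ W →L[ℝ] W) φ) = φ)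
    (hH : ∀ φ : StrongDual ℝ W, ∃ u, Bhat u = φ ∧
      ∀ ψ : StrongDual ℝ W, Tendsto (fun ε => ψ (R ε φ)) (𝓝[>] 0) (𝓝 (ψ u)))
    (u : W) (ψ : StrongDual ℝ W) :
    Tendsto (fun ε => ψ (R ε (Bhat u))) (𝓝[>] 0) (𝓝 (ψ u)) := by
  have hRb : ∀ ε > 0, ∀ φ, ‖R ε φ‖ ≤ c⁻¹ * ‖φ‖ := fun ε hε φ => by
    have := coercive_le_norm (hB ε hε) (R ε φ)
    rw [hR ε hε] at this
    rwa [inv_mul_eq_div, le_div_iff₀' hc]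
  let P : Submodule ℝ W :=
    { carrier := {u | ∀ ψ : StrongDual ℝ W,
        Tendsto (fun ε => ψ (R ε (Bhat u))) (𝓝[>] 0) (𝓝 (ψ u))}
      zero_mem' := fun ψ => by simp
      add_mem' := fun {u v} hu hv ψ => by simpa using (hu ψ).add (hv ψ)
      smul_mem' := fun t u hu ψ => by simpa using (hu ψ).const_mul t }
  -- Coercivity bounds the solution operators by `c⁻¹` uniformly in `ε`, so weak convergence passes
  -- to norm limits of `u`.
  have hPc : IsClosed (P : Set W) := by
    refine isClosed_of_closure_subset fun u hu ψ => ?_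
    rw [Metric.tendsto_nhds]
    intro η hη
    set K := ‖ψ‖ * (c⁻¹ * ‖Bhat‖) + ‖ψ‖ + 1
    have hK : 0 < K := by positivity
    obtain ⟨v, hv, huv⟩ := Metric.mem_closure_iff.1 hu (η / 2 / K) (by positivity)
    have hv := hv ψ
    rw [Metric.tendsto_nhds] at hv
    filter_upwards [hv (η / 2) (by positivity), self_mem_nhdsWithin] with ε h1 hε
    rw [Real.dist_eq] at h1 ⊢
    rw [dist_eq_norm, lt_div_iff₀ hK] at huv
    have e1 : |ψ (R ε (Bhat (u - v)))| ≤ ‖ψ‖ * (c⁻¹ * ‖Bhat‖) * ‖u - v‖ := by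
      calc |ψ (R ε (Bhat (u - v)))| ≤ ‖ψ‖ * ‖R ε (Bhat (u - v))‖ := ψ.le_opNorm _
        _ ≤ ‖ψ‖ * (c⁻¹ * (‖Bhat‖ * ‖u - v‖)) := by
          gcongr
          exact (hRb ε hε _).trans (by gcongr; exact Bhat.le_opNorm _)
        _ = _ := by ring
    have e2 : |ψ (u - v)| ≤ ‖ψ‖ * ‖u - v‖ := ψ.le_opNorm _
    have e3 : ψ (R ε (Bhat u)) - ψ u =
        (ψ (R ε (Bhat v)) - ψ v) + ψ (R ε (Bhat (u - v))) - ψ (u - v) := by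
      simp only [map_sub]; ring
    rw [e3]
    have e4 := abs_add_le (ψ (R ε (Bhat v)) - ψ v) (ψ (R ε (Bhat (u - v))))
    have e5 := abs_sub (ψ (R ε (Bhat v)) - ψ v + ψ (R ε (Bhat (u - v)))) (ψ (u - v))
    nlinarith [norm_nonneg (u - v)]
  -- For `w ⊥ P`, let `v` be the given solution of `Bhat v = ⟨w, ·⟩`. It lies in `P`, so `⟨w, v⟩ =
  -- 0`. Coercivity and the bound `M` give `c ‖w‖² ≤ M² ⟨w, R ε ⟨w, ·⟩⟩`, and the right-hand side
  -- tends to `M² ⟨w, v⟩ = 0`.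
  have hPt : P = ⊤ := by
    have : CompleteSpace P := hPc.completeSpace_coe
    rw [← Submodule.orthogonal_eq_bot_iff, eq_bot_iff]
    intro w hw
    obtain ⟨v, hv, hvl⟩ := hH (innerSL ℝ w)
    have hvP : v ∈ P := fun ψ => by rw [hv]; exact hvl ψ
    have h0 : innerSL ℝ w v = 0 := by
      rw [innerSL_apply_apply, real_inner_comm]
      exact (Submodule.mem_orthogonal P w).1 hw v hvP
    have hlim := hvl (innerSL ℝ w)
    rw [h0] at hlim
    have hnn : ∀ᶠ ε in 𝓝[>] (0 : ℝ),
        c * ‖w‖ ^ 2 ≤ M ^ 2 * innerSL ℝ w (R ε (innerSL ℝ w)) := by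
      filter_upwards [self_mem_nhdsWithin] with ε hε
      have h1 := hB ε hε (R ε (innerSL ℝ w))
      rw [hR ε hε] at h1
      have h2 : ‖w‖ ≤ M * ‖R ε (innerSL ℝ w)‖ := by
        calc ‖w‖ = ‖B ε (R ε (innerSL ℝ w))‖ := by rw [hR ε hε, innerSL_apply_norm]
          _ ≤ ‖B ε‖ * ‖R ε (innerSL ℝ w)‖ := (B ε).le_opNorm _
          _ ≤ _ := by gcongr; exact hM ε hε
      calc c * ‖w‖ ^ 2 ≤ c * (M * ‖R ε (innerSL ℝ w)‖) ^ 2 := by gcongr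
        _ = M ^ 2 * (c * ‖R ε (innerSL ℝ w)‖ ^ 2) := by ring
        _ ≤ _ := by gcongr
    have := ge_of_tendsto (hlim.const_mul (M ^ 2)) hnn
    rw [mul_zero] at this
    have h3 := nonpos_of_mul_nonpos_right this hc
    rw [Submodule.mem_bot, ← norm_eq_zero]
    exact pow_eq_zero_iff (two_ne_zero) |>.1 (le_antisymm h3 (sq_nonneg _))
  have : u ∈ P := hPt ▸ Submodule.mem_top
  exact this ψ

/-- By coercivity, `w k` differs from the exact solution with right-hand side `Bhat u` by at most
`c⁻¹` times the error in the right-hand side; hence both have the same weak limit. -/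
theorem tendsto_of_tendsto_rhs_of_coercive [CompleteSpace W]
    {B : ℝ → W →L[ℝ] StrongDual ℝ W} {Bhat : W →L[ℝ] StrongDual ℝ W} {c M : ℝ} (hc : 0 < c)
    (hB : ∀ ε > 0, ∀ u, c * ‖u‖ ^ 2 ≤ B ε u u) (hM : ∀ ε > 0, ‖B ε‖ ≤ M)
    (hH : ∀ φ : StrongDual ℝ W, ∃ u, Bhat u = φ ∧
      ∀ w : ℝ → W, (∀ ε > 0, B ε (w ε) = φ) →
        ∀ ψ : StrongDual ℝ W, Tendsto (fun ε => ψ (w ε)) (𝓝[>] 0) (𝓝 (ψ u)))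
    {κ : Type*} {l : Filter κ} {e : κ → ℝ} (he : Tendsto e l (𝓝[>] 0)) {w : κ → W} {u : W}
    (hw : Tendsto (fun k => B (e k) (w k)) l (𝓝 (Bhat u))) (ψ : StrongDual ℝ W) :
    Tendsto (fun k => ψ (w k)) l (𝓝 (ψ u)) := by
  have hex : ∀ ε, ∃ R : StrongDual ℝ W →L[ℝ] W, 0 < ε → ∀ φ, B ε (R φ) = φ := fun ε => by
    by_cases hε : 0 < ε
    · obtain ⟨R, hR⟩ := coercive_exists_rightInverse hc (hB ε hε)
      exact ⟨R, fun _ => hR⟩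
    · exact ⟨0, fun h => absurd h hε⟩
  choose R hR using hex
  have h1 := (tendsto_solution_of_coercive hc hB hM hR (fun φ => by
    obtain ⟨u, hu, h⟩ := hH φ
    exact ⟨u, hu, h _ fun ε hε => hR ε hε φ⟩) u ψ).comp he
  have h2 : Tendsto (fun k => w k - R (e k) (Bhat u)) l (𝓝 0) := by
    have h3 : Tendsto (fun k => c⁻¹ * ‖B (e k) (w k) - Bhat u‖) l (𝓝 0) := by
      have := (tendsto_iff_norm_sub_tendsto_zero.1 hw).const_mul c⁻¹
      rwa [mul_zero] at this
    refine squeeze_zero_norm' ?_ h3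
    filter_upwards [he self_mem_nhdsWithin] with k hk
    have := coercive_le_norm (hB (e k) hk) (w k - R (e k) (Bhat u))
    rw [map_sub, hR (e k) hk] at this
    rwa [inv_mul_eq_div, le_div_iff₀' hc]
  have h3 := ((ψ.continuous.tendsto 0).comp h2).add h1
  simpa using h3

end Hilbert

/-! ### The Poincaré inequality -/

theorem integrable_sq_of_hasCompactSupport {N : ℕ} {h : Sp N → ℝ} (hh : Continuous h)
    (hc : HasCompactSupport h) : Integrable fun x => h x ^ 2 := by
  have h1 : Continuous fun x => h x ^ 2 := by fun_prop
  have h2 : HasCompactSupport fun x => h x ^ 2 := hc.comp_left (g := fun t => t ^ 2) (by simp)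
  exact h1.integrable_of_hasCompactSupport h2

/-- Since `∂_i x_i = 1`, integration by parts gives `∫ h² = -∫ 2 x_i h ∂_i h`. Young's inequality,
with `|x_i| ≤ R` on the support, lets half of the left-hand side be absorbed. -/
theorem integral_sq_le_integral_sq_fderiv {N : ℕ} (i : Fin N) {h : Sp N → ℝ}
    (hh : ContDiff ℝ ∞ h) (hc : HasCompactSupport h) {R : ℝ}
    (hR : ∀ x ∈ tsupport h, ‖x‖ ≤ R) :
    ∫ x, h x ^ 2 ≤ 4 * R ^ 2 * ∫ x, (fderiv ℝ h x (EuclideanSpace.single i 1)) ^ 2 := by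
  set v : Sp N := EuclideanSpace.single i 1
  have hd : Continuous fun x => fderiv ℝ h x v :=
    (hh.continuous_fderiv (by simp)).clm_apply continuous_const
  have hdc : HasCompactSupport fun x => fderiv ℝ h x v := hc.fderiv_apply (𝕜 := ℝ) v
  have i1 : Integrable fun x => h x ^ 2 :=
    integrable_sq_of_hasCompactSupport hh.continuous hc
  have i2 : Integrable fun x => (fderiv ℝ h x v) ^ 2 :=
    integrable_sq_of_hasCompactSupport hd hdc
  have hp : ∀ x, fderiv ℝ (fun y : Sp N => y i) x v = 1 := fun x => by
    have : HasFDerivAt (fun y : Sp N => y i) (EuclideanSpace.proj i : Sp N →L[ℝ] ℝ) x :=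
      (EuclideanSpace.proj i : Sp N →L[ℝ] ℝ).hasFDerivAt
    rw [this.fderiv]
    simp [v]
  have hs : ∀ x, fderiv ℝ (fun y => h y ^ 2) x v = 2 * h x * fderiv ℝ h x v := fun x => by
    have := ((hh.differentiable (by simp) x).hasFDerivAt.pow 2).fderiv
    simp [this]
  have hpc : Continuous fun x : Sp N => x i := (EuclideanSpace.proj i : Sp N →L[ℝ] ℝ).continuous
  have hsc : HasCompactSupport fun x => h x ^ 2 := hc.comp_left (g := fun t => t ^ 2) (by simp)
  have i3 : Integrable fun x : Sp N => x i * (2 * h x * fderiv ℝ h x v) := by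
    have h1 : Continuous fun x : Sp N => x i * (2 * h x * fderiv ℝ h x v) :=
      hpc.mul ((continuous_const.mul hh.continuous).mul hd)
    exact h1.integrable_of_hasCompactSupport hdc.mul_left.mul_left
  have i4 : Integrable fun x : Sp N => x i * h x ^ 2 := by
    have h1 : Continuous fun x : Sp N => x i * h x ^ 2 := hpc.mul (hh.continuous.pow 2)
    exact h1.integrable_of_hasCompactSupport hsc.mul_left
  have key := integral_mul_fderiv_eq_neg_fderiv_mul_of_integrable (μ := (volume : Measure (Sp N)))
    (f := fun x : Sp N => x i) (g := fun x => h x ^ 2) (v := v)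
    (by simpa only [hp, one_mul] using i1) (by simpa only [hs] using i3)
    i4
    (fun x _ => (EuclideanSpace.proj i : Sp N →L[ℝ] ℝ).differentiableAt)
    (fun x _ => (hh.pow 2).differentiable (by simp) x)
  simp only [hp, hs, one_mul] at key
  have hle : ∫ x, -(x i * (2 * h x * fderiv ℝ h x v)) ≤
      ∫ x, (1 / 2 * h x ^ 2 + 2 * R ^ 2 * (fderiv ℝ h x v) ^ 2) := by
    refine integral_mono i3.neg ((i1.const_mul _).add (i2.const_mul _)) fun x => ?_
    by_cases hx : x ∈ tsupport h
    · have h1 : (x i) ^ 2 ≤ R ^ 2 := by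
        rw [← sq_abs]
        have := PiLp.norm_apply_le x i
        rw [Real.norm_eq_abs] at this
        exact pow_le_pow_left₀ (abs_nonneg _) (this.trans (hR x hx)) 2
      have h2 := mul_le_mul_of_nonneg_right h1 (sq_nonneg (fderiv ℝ h x v))
      simp only
      nlinarith [sq_nonneg (h x + 2 * (x i * fderiv ℝ h x v))]
    · have : h x = 0 := image_eq_zero_of_notMem_tsupport hx
      simp only [this]
      have := sq_nonneg (R * fderiv ℝ h x v)
      simp only [mul_zero, zero_mul, neg_zero]
      positivity
  rw [integral_add (i1.const_mul _) (i2.const_mul _), integral_const_mul, integral_const_mul,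
    integral_neg, key] at hle
  linarith

theorem norm_sq_eq_integral {X E : Type*} [MeasurableSpace X] {μ : Measure X}
    [NormedAddCommGroup E] [InnerProductSpace ℝ E] (u : Lp E 2 μ) :
    ‖u‖ ^ 2 = ∫ x, ‖u x‖ ^ 2 ∂μ := by
  rw [← real_inner_self_eq_norm_sq, L2.inner_def]
  simp only [real_inner_self_eq_norm_sq]

theorem integrable_norm_sq {X E : Type*} [MeasurableSpace X] {μ : Measure X}
    [NormedAddCommGroup E] [InnerProductSpace ℝ E] (u : Lp E 2 μ) :
    Integrable (fun x => ‖u x‖ ^ 2) μ := by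
  refine (L2.integrable_inner (𝕜 := ℝ) u u).congr (Eventually.of_forall fun x => ?_)
  exact real_inner_self_eq_norm_sq _

/-- The one-dimensional estimate in a single direction `i`, summed over the components of `ψ`; the
other partial derivatives only enlarge the right-hand side. -/
theorem testPairs_norm_sq_le {N n : ℕ} {Ω : Set (Sp N)} (i : Fin N) {R : ℝ}
    (hR : ∀ x ∈ Ω, ‖x‖ ≤ R) {z : WithLp 2 (LpVec Ω n 2 × LpGr Ω n 2)} (hz : z ∈ testPairs Ω n) :
    ‖z.fst‖ ^ 2 ≤ 4 * R ^ 2 * ‖z.snd‖ ^ 2 := by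
  obtain ⟨ψ, h1, h2, h3, h4, h5⟩ := hz
  have hsm : ∀ α, ContDiff ℝ ∞ fun x => ψ x α := fun α =>
    (EuclideanSpace.proj α : Sp n →L[ℝ] ℝ).contDiff.comp h1
  have hsupp : ∀ α, Function.support (fun x => ψ x α) ⊆ Function.support ψ := fun α x hx => by
    rw [Function.mem_support] at hx ⊢
    exact fun h0 => hx (by simp [h0])
  have hcs : ∀ α, HasCompactSupport fun x => ψ x α := fun α =>
    h2.mono (hsupp α)
  have hts : ∀ α, tsupport (fun x => ψ x α) ⊆ Ω := fun α => (closure_mono (hsupp α)).trans h3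
  have hjac : ∀ α x, fderiv ℝ (fun x => ψ x α) x (EuclideanSpace.single i 1) =
      jac ψ x (α, i) := fun α x => by
    have := ((EuclideanSpace.proj α : Sp n →L[ℝ] ℝ).hasFDerivAt.comp x
      (h1.differentiable (by simp) x).hasFDerivAt).fderiv
    simp only [jac]
    change fderiv ℝ ((EuclideanSpace.proj α : Sp n →L[ℝ] ℝ) ∘ ψ) x _ = _
    rw [this]
    rfl
  have hd : ∀ α, Continuous fun x => jac ψ x (α, i) := fun α => by
    simp only [← hjac]
    exact ((hsm α).continuous_fderiv (by simp)).clm_apply continuous_const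
  have hdc : ∀ α, HasCompactSupport fun x => jac ψ x (α, i) := fun α => by
    simp only [← hjac]
    exact (hcs α).fderiv_apply (𝕜 := ℝ) _
  have j1 : ∀ α, Integrable fun x => ψ x α ^ 2 := fun α =>
    integrable_sq_of_hasCompactSupport (hsm α).continuous (hcs α)
  have j2 : ∀ α, Integrable fun x => jac ψ x (α, i) ^ 2 := fun α =>
    integrable_sq_of_hasCompactSupport (hd α) (hdc α)
  have e1 : ∫ x in Ω, ∑ α, ψ x α ^ 2 = ∫ x, ∑ α, ψ x α ^ 2 := by
    refine setIntegral_eq_integral_of_forall_compl_eq_zero fun x hx => ?_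
    refine Finset.sum_eq_zero fun α _ => ?_
    have := image_eq_zero_of_notMem_tsupport fun h => hx (hts α h)
    simp only at this
    rw [this]
    simp
  have e2 : ∫ x in Ω, ∑ α, jac ψ x (α, i) ^ 2 = ∫ x, ∑ α, jac ψ x (α, i) ^ 2 := by
    refine setIntegral_eq_integral_of_forall_compl_eq_zero fun x hx => ?_
    refine Finset.sum_eq_zero fun α _ => ?_
    rw [← hjac, image_eq_zero_of_notMem_tsupport (f := fderiv ℝ fun x => ψ x α)
      fun h => hx (hts α (tsupport_fderiv_subset ℝ h))]
    simp
  have hz1 : ‖z.fst‖ ^ 2 = ∑ α, ∫ x, ψ x α ^ 2 := by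
    rw [norm_sq_eq_integral, ← integral_finsetSum _ fun α _ => j1 α, ← e1]
    refine integral_congr_ae ?_
    filter_upwards [h4] with x hx
    rw [hx, EuclideanSpace.real_norm_sq_eq]
  have hz2 : ∑ α, ∫ x, jac ψ x (α, i) ^ 2 ≤ ‖z.snd‖ ^ 2 := by
    rw [norm_sq_eq_integral, ← integral_finsetSum _ fun α _ => j2 α, ← e2]
    refine integral_mono_ae ?_ (integrable_norm_sq _) ?_
    · exact (integrable_finsetSum _ fun α _ => j2 α).restrict
    · filter_upwards [h5] with x hx
      rw [hx, EuclideanSpace.real_norm_sq_eq, Fintype.sum_prod_type]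
      exact Finset.sum_le_sum fun α _ => Finset.single_le_sum
        (f := fun i => jac ψ x (α, i) ^ 2) (fun _ _ => sq_nonneg _) (Finset.mem_univ i)
  rw [hz1]
  refine le_trans ?_ (mul_le_mul_of_nonneg_left hz2 (by positivity))
  rw [Finset.mul_sum]
  refine Finset.sum_le_sum fun α _ => ?_
  have := integral_sq_le_integral_sq_fderiv i (hsm α) (hcs α) fun x hx => hR x (hts α hx)
  simpa only [hjac] using this

theorem W012_norm_sq_le {N n : ℕ} {Ω : Set (Sp N)} (i : Fin N) {R : ℝ}
    (hR : ∀ x ∈ Ω, ‖x‖ ≤ R) (u : W012 Ω n) :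
    ‖u‖ ^ 2 ≤ (4 * R ^ 2 + 1) * ‖grad Ω n u‖ ^ 2 := by
  have hcl : IsClosed {z : WithLp 2 (LpVec Ω n 2 × LpGr Ω n 2) |
      ‖z.fst‖ ^ 2 ≤ 4 * R ^ 2 * ‖z.snd‖ ^ 2} := by
    refine isClosed_le ?_ ?_
    · exact ((WithLp.fstL 2 ℝ (LpVec Ω n 2) (LpGr Ω n 2)).continuous.norm.pow 2)
    · exact ((WithLp.sndL 2 ℝ (LpVec Ω n 2) (LpGr Ω n 2)).continuous.norm.pow 2).const_mul _
  have h := closure_minimal (fun z hz => testPairs_norm_sq_le i hR hz) hcl u.2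
  have e : ‖u‖ ^ 2 = ‖u.1.fst‖ ^ 2 + ‖u.1.snd‖ ^ 2 := WithLp.prod_norm_sq_eq_of_L2 u.1
  have e2 : grad Ω n u = u.1.snd := rfl
  rw [e, e2]
  have h' : ‖u.1.fst‖ ^ 2 ≤ 4 * R ^ 2 * ‖u.1.snd‖ ^ 2 := h
  linarith

/-! ### The operator `A` -/

section opA

variable {N n : ℕ} {Ω : Set (Sp N)}

theorem integrable_flux_mul_grad (a : Tensor Ω n) (u φ : W012 Ω n) (α : Fin n) (i : Fin N) :
    Integrable (fun x => (∑ β, ∑ j, a α β i j x * grad Ω n u x (β, j)) * grad Ω n φ x (α, i))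
      (volume.restrict Ω) := by
  refine (L2.integrable_inner (𝕜 := ℝ) (comp Ω n (α, i) (grad Ω n φ)) (flux a α i u)).congr ?_
  filter_upwards [flux_ae a α i u, comp_ae (α, i) (grad Ω n φ)] with x h1 h2
  simp [h1, h2]

theorem opA_eq_integral (a : Tensor Ω n) (u φ : W012 Ω n) :
    opA a u φ = ∫ x in Ω, ∑ α, ∑ i,
      (∑ β, ∑ j, a α β i j x * grad Ω n u x (β, j)) * grad Ω n φ x (α, i) := by
  rw [opA_apply, integral_finsetSum _ fun α _ => integrable_finsetSum _ fun i _ =>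
    integrable_flux_mul_grad a u φ α i]
  exact Finset.sum_congr rfl fun α _ => (integral_finsetSum _ fun i _ =>
    integrable_flux_mul_grad a u φ α i).symm

theorem IsLegendre.le_opA {c : ℝ} {a : Tensor Ω n} (ha : IsLegendre c a) (u : W012 Ω n) :
    c * ‖grad Ω n u‖ ^ 2 ≤ opA a u u := by
  rw [opA_eq_integral, norm_sq_eq_integral, ← integral_const_mul]
  refine integral_mono_ae ((integrable_norm_sq _).const_mul c)
    (integrable_finsetSum _ fun α _ => integrable_finsetSum _ fun i _ =>
      integrable_flux_mul_grad a u u α i) ?_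
  filter_upwards [ha] with x hx
  have := hx (grad Ω n u x)
  rw [EuclideanSpace.real_norm_sq_eq, Fintype.sum_prod_type]
  refine this.trans_eq ?_
  refine Finset.sum_congr rfl fun α _ => ?_
  rw [Finset.sum_comm]
  refine Finset.sum_congr rfl fun i _ => ?_
  rw [Finset.sum_mul]
  refine Finset.sum_congr rfl fun β _ => ?_
  rw [Finset.sum_mul]
  exact Finset.sum_congr rfl fun j _ => by ring

theorem exists_coercive_opA (hΩ : Bornology.IsBounded Ω) (hN : N ≠ 0) {c : ℝ} (hc : 0 < c) :
    ∃ c' > 0, ∀ a : Tensor Ω n, IsLegendre c a → ∀ u, c' * ‖u‖ ^ 2 ≤ opA a u u := by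
  obtain ⟨R, hR⟩ := hΩ.exists_norm_le
  refine ⟨c / (4 * R ^ 2 + 1), by positivity, fun a ha u => le_trans ?_ (ha.le_opA u)⟩
  have := W012_norm_sq_le ⟨0, Nat.pos_of_ne_zero hN⟩ hR u
  rw [div_mul_eq_mul_div, div_le_iff₀ (by positivity)]
  nlinarith

theorem exists_norm_opA_le (M : ℝ) :
    ∃ M' : ℝ, ∀ a : Tensor Ω n, (∀ α β i j, ‖a α β i j‖ ≤ M) → ‖opA a‖ ≤ M' := by
  set μ := volume.restrict Ω
  have hfl : ∀ a : Tensor Ω n, (∀ α β i j, ‖a α β i j‖ ≤ M) → ∀ α i, ‖flux a α i‖ ≤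
      ∑ β : Fin n, ∑ j : Fin N, ‖(ContinuousLinearMap.mul ℝ ℝ).holderL μ ∞ 2 2‖ * M *
        ‖comp Ω n (β, j) ∘L grad Ω n‖ := fun a ha α i => by
    refine (norm_sum_le _ _).trans (Finset.sum_le_sum fun β _ => ?_)
    refine (norm_sum_le _ _).trans (Finset.sum_le_sum fun j _ => ?_)
    refine (ContinuousLinearMap.opNorm_comp_le _ _).trans ?_
    gcongr
    exact (ContinuousLinearMap.le_opNorm _ _).trans (by gcongr; exact ha α β i j)
  refine ⟨∑ α : Fin n, ∑ i : Fin N, (∑ β : Fin n, ∑ j : Fin N,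
    ‖(ContinuousLinearMap.mul ℝ ℝ).holderL μ ∞ 2 2‖ * M * ‖comp Ω n (β, j) ∘L grad Ω n‖) *
      ‖comp Ω n (α, i) ∘L grad Ω n‖, fun a ha => ?_⟩
  refine (norm_sum_le _ _).trans (Finset.sum_le_sum fun α _ => ?_)
  refine (norm_sum_le _ _).trans (Finset.sum_le_sum fun i _ => ?_)
  refine ContinuousLinearMap.opNorm_le_bound₂ _ ?_ fun u φ => ?_
  · exact mul_nonneg ((norm_nonneg _).trans (hfl a ha α i)) (norm_nonneg _)
  · rw [ContinuousLinearMap.bilinearComp_apply, innerSL_apply_apply]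
    refine (norm_inner_le_norm _ _).trans ?_
    calc ‖flux a α i u‖ * ‖(comp Ω n (α, i) ∘L grad Ω n) φ‖
        ≤ (‖flux a α i‖ * ‖u‖) * (‖comp Ω n (α, i) ∘L grad Ω n‖ * ‖φ‖) := by
          gcongr
          · exact ContinuousLinearMap.le_opNorm _ _
          · exact ContinuousLinearMap.le_opNorm _ _
      _ = ‖flux a α i‖ * ‖comp Ω n (α, i) ∘L grad Ω n‖ * ‖u‖ * ‖φ‖ := by ring
      _ ≤ _ := by gcongr; exact hfl a ha α i

end opA

/-! ### Consequences of H-convergence -/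

section HConvergence

variable {N n : ℕ} {Ω : Set (Sp N)} {a : ℝ → Tensor Ω n} {ahat : Tensor Ω n}

theorem exists_coercive_opA_of_HConverges (hΩ : Bornology.IsBounded Ω)
    (ha_leg : ∃ c > 0, ∀ ε > 0, IsLegendre c (a ε)) (ha_H : HConverges a ahat) :
    ∃ c > 0, ∀ ε > 0, ∀ u, c * ‖u‖ ^ 2 ≤ opA (a ε) u u := by
  obtain ⟨c, hc, hleg⟩ := ha_leg
  by_cases hN : N = 0
  -- For `N = 0` there is no gradient and every `opA` vanishes. Solvability of `opA ahat v = φ` for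
  -- all `φ` then forces `W` to be trivial.
  · subst hN
    have h0 : ∀ (b : Tensor Ω n) (u φ : W012 Ω n), opA b u φ = 0 := fun b u φ => by
      simp [opA_apply]
    refine ⟨1, one_pos, fun ε _ u => ?_⟩
    obtain ⟨v, hv, -⟩ := ha_H (innerSL ℝ u)
    have h1 : innerSL ℝ u u = 0 := by rw [← hv, h0]
    rw [innerSL_apply_apply, real_inner_self_eq_norm_sq] at h1
    rw [h1, h0, mul_zero]
  · obtain ⟨c', hc', h⟩ := exists_coercive_opA (n := n) hΩ hN hc
    exact ⟨c', hc', fun ε hε => h _ (hleg ε hε)⟩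

theorem HConverges.tendsto_of_tendsto_opA (hΩ : Bornology.IsBounded Ω)
    (ha_bdd : ∃ M : ℝ, ∀ ε > 0, ∀ α β i j, ‖a ε α β i j‖ ≤ M)
    (ha_leg : ∃ c > 0, ∀ ε > 0, IsLegendre c (a ε)) (ha_H : HConverges a ahat)
    {κ : Type*} {l : Filter κ} {e : κ → ℝ} (he : Tendsto e l (𝓝[>] 0)) {w : κ → W012 Ω n}
    {u : W012 Ω n} (hw : Tendsto (fun k => opA (a (e k)) (w k)) l (𝓝 (opA ahat u)))
    (ψ : Wneg Ω n) : Tendsto (fun k => ψ (w k)) l (𝓝 (ψ u)) := by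
  obtain ⟨c, hc, hco⟩ := exists_coercive_opA_of_HConverges hΩ ha_leg ha_H
  obtain ⟨M, hM⟩ := ha_bdd
  obtain ⟨M', hM'⟩ := exists_norm_opA_le (Ω := Ω) (n := n) M
  refine tendsto_of_tendsto_rhs_of_coercive (B := fun ε => opA (a ε)) hc hco
    (fun ε hε => hM' _ (hM ε hε)) (fun φ => ?_) he hw ψ
  obtain ⟨v, hv, h⟩ := ha_H φ
  exact ⟨v, hv, fun w hw => (h w hw).1⟩

/-- If `Â u = 0`, the zero family has right-hand sides converging to `Â u`, so its weak limit is
`u`. -/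
theorem HConverges.injective (hΩ : Bornology.IsBounded Ω)
    (ha_bdd : ∃ M : ℝ, ∀ ε > 0, ∀ α β i j, ‖a ε α β i j‖ ≤ M)
    (ha_leg : ∃ c > 0, ∀ ε > 0, IsLegendre c (a ε)) (ha_H : HConverges a ahat) :
    Function.Injective (opA ahat) := by
  refine (injective_iff_map_eq_zero (opA ahat)).2 fun u hu => ?_
  have h := ha_H.tendsto_of_tendsto_opA hΩ ha_bdd ha_leg (l := 𝓝[>] 0) tendsto_id
    (w := fun _ => 0) (u := u) (by simp [hu]) (innerSL ℝ u)
  have h1 := tendsto_nhds_unique h (tendsto_const_nhds (x := innerSL ℝ u 0))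
  rw [map_zero, innerSL_apply_apply] at h1
  exact inner_self_eq_zero.1 h1

end HConvergence

/-! ### The space `W ∩ C`: limits, weak solutions, equivalent norms -/

section W0C

variable {N n : ℕ} {Ω : Set (Sp N)}

theorem continuousOn_ext0 (v : CBar Ω n) : ContinuousOn (ext0 v) (closure Ω) := by
  rw [continuousOn_iff_continuous_domRestrict]
  have : (closure Ω).domRestrict (ext0 v) = v := funext fun x => ext0_apply v x
  rw [this]
  exact v.continuous

theorem norm_ext0_le (v : CBar Ω n) (x : Sp N) : ‖ext0 v x‖ ≤ ‖v‖ := by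
  by_cases hx : x ∈ closure Ω
  · exact (congrArg norm (ext0_apply v ⟨x, hx⟩)).trans_le (v.norm_coe_le_norm _)
  · have : ext0 v x = 0 := Function.extend_apply' _ _ _ (by rintro ⟨y, rfl⟩; exact hx y.2)
    rw [this, norm_zero]
    exact norm_nonneg _

theorem memLp_ext0 (hΩ : Bornology.IsBounded Ω) (v : CBar Ω n) :
    MemLp (ext0 v) 2 (volume.restrict Ω) := by
  have : IsFiniteMeasure (volume.restrict Ω) :=
    ⟨by simpa using hΩ.measure_lt_top⟩
  refine MemLp.of_bound ?_ ‖v‖ (Eventually.of_forall fun x => norm_ext0_le v x)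
  exact ((continuousOn_ext0 v).aestronglyMeasurable isClosed_closure.measurableSet).mono_measure
    (Measure.restrict_mono subset_closure le_rfl)

theorem tendsto_toLp_ext0 (hΩ : Bornology.IsBounded Ω) {κ : Type*} {l : Filter κ}
    {w : κ → CBar Ω n} {v : CBar Ω n} (h : Tendsto w l (𝓝 v)) :
    Tendsto (fun k => (memLp_ext0 hΩ (w k)).toLp) l (𝓝 (memLp_ext0 hΩ v).toLp) := by
  have : IsFiniteMeasure (volume.restrict Ω) :=
    ⟨by simpa using hΩ.measure_lt_top⟩
  rw [tendsto_iff_norm_sub_tendsto_zero] at h ⊢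
  have h' := h.const_mul ((measureUnivNNReal (volume.restrict Ω) : ℝ) ^ (2 : ℝ≥0∞).toReal⁻¹)
  rw [mul_zero] at h'
  refine squeeze_zero (fun _ => norm_nonneg _) (fun k => ?_) h'
  refine Lp.norm_le_of_ae_bound (norm_nonneg _) ?_
  filter_upwards [Lp.coeFn_sub (memLp_ext0 hΩ (w k)).toLp (memLp_ext0 hΩ v).toLp,
    (memLp_ext0 hΩ (w k)).coeFn_toLp, (memLp_ext0 hΩ v).coeFn_toLp] with x h1 h2 h3
  rw [h1, Pi.sub_apply, h2, h3]
  have e : ext0 (w k) = ext0 (w k - v) + ext0 v := by rw [← ext0_add, sub_add_cancel]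
  rw [e, Pi.add_apply, add_sub_cancel_right]
  exact norm_ext0_le _ x

/-- Uniform convergence on the bounded set `Ω` implies convergence in `L²`, so the weak `L²` limit
and the uniform limit are the same function. -/
theorem mem_W0C_of_tendsto (hΩ : Bornology.IsBounded Ω) {κ : Type*} {l : Filter κ} [l.NeBot]
    {w : κ → W0C Ω n} {u : W012 Ω n} {v : CBar Ω n}
    (hu : ∀ ψ : Wneg Ω n, Tendsto (fun k => ψ (toW Ω n (w k))) l (𝓝 (ψ u)))
    (hv : Tendsto (fun k => toC Ω n (w k)) l (𝓝 v)) : (u, v) ∈ W0C Ω n := by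
  have hw : ∀ k, (toW Ω n (w k)).fn = (memLp_ext0 hΩ (toC Ω n (w k))).toLp := fun k => by
    have h : (toW Ω n (w k)).fn =ᵐ[volume.restrict Ω] ext0 (toC Ω n (w k)) := (w k).2
    exact Lp.ext (h.trans (memLp_ext0 hΩ _).coeFn_toLp.symm)
  have hfn : u.fn = (memLp_ext0 hΩ v).toLp := by
    refine ext_inner_left ℝ fun h => ?_
    have h1 := hu (innerSL ℝ h ∘L (WithLp.fstL 2 ℝ (LpVec Ω n 2) (LpGr Ω n 2)) ∘L
      (testPairs Ω n).topologicalClosure.subtypeL)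
    have h2 := ((innerSL ℝ h).continuous.tendsto _).comp (tendsto_toLp_ext0 hΩ hv)
    refine tendsto_nhds_unique h1 (h2.congr fun k => ?_)
    rw [Function.comp_apply, ← hw k]
    rfl
  change u.fn =ᵐ[_] ext0 v
  rw [hfn]
  exact (memLp_ext0 hΩ v).coeFn_toLp

/-- Continuous functions that agree almost everywhere on the open set `Ω` agree on `Ω`, hence on its
closure. -/
theorem toW_injective (hΩ : IsOpen Ω) : Function.Injective (toW Ω n) := by
  intro u w h
  refine Subtype.ext (Prod.ext h ?_)
  have h1 : ext0 u.1.2 =ᵐ[volume.restrict Ω] ext0 w.1.2 := by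
    have hu : u.1.1.fn =ᵐ[_] ext0 u.1.2 := u.2
    have hw : w.1.1.fn =ᵐ[_] ext0 w.1.2 := w.2
    have h' : u.1.1 = w.1.1 := h
    rw [h'] at hu
    exact hu.symm.trans hw
  have h2 : EqOn (ext0 u.1.2) (ext0 w.1.2) Ω :=
    Measure.eqOn_open_of_ae_eq h1 hΩ ((continuousOn_ext0 _).mono subset_closure)
      ((continuousOn_ext0 _).mono subset_closure)
  have h3 := h2.of_subset_closure (continuousOn_ext0 _) (continuousOn_ext0 _) subset_closure
    subset_rfl
  ext1 x
  rw [← ext0_apply, ← ext0_apply]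
  exact h3 x.2

/-- Weak limits of functions `w k ∈ W₀^{1,2} ∩ C` whose images under the operators of an
H-convergent family converge in `W^{-1,2}`. -/
theorem HConverges.exists_W0C_limit {a : ℝ → Tensor Ω n} {ahat : Tensor Ω n}
    (hΩ : Bornology.IsBounded Ω)
    (ha_bdd : ∃ M : ℝ, ∀ ε > 0, ∀ α β i j, ‖a ε α β i j‖ ≤ M)
    (ha_leg : ∃ c > 0, ∀ ε > 0, IsLegendre c (a ε)) (ha_H : HConverges a ahat)
    {κ : Type*} {l : Filter κ} [l.NeBot] {e : κ → ℝ} (he : Tendsto e l (𝓝[>] 0))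
    {w : κ → W0C Ω n} {v : CBar Ω n} (hv : Tendsto (fun k => toC Ω n (w k)) l (𝓝 v))
    {φ : Wneg Ω n} (hw : Tendsto (fun k => opA (a (e k)) (toW Ω n (w k))) l (𝓝 φ)) :
    ∃ z : W0C Ω n, toC Ω n z = v ∧ opA ahat (toW Ω n z) = φ := by
  obtain ⟨u, rfl, -⟩ := ha_H φ
  exact ⟨⟨(u, v), mem_W0C_of_tendsto hΩ
    (ha_H.tendsto_of_tendsto_opA hΩ ha_bdd ha_leg he hw) hv⟩, rfl, rfl⟩

theorem integrable_mul_grad (hΩ : Bornology.IsBounded Ω) {p : ℝ≥0∞} (hp : 2 ≤ p)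
    {g : Sp N → Gr n N} (hg : MemLp g p (volume.restrict Ω)) (φ : W012 Ω n) (α : Fin n)
    (i : Fin N) :
    Integrable (fun x => g x (α, i) * grad Ω n φ x (α, i)) (volume.restrict Ω) := by
  have : IsFiniteMeasure (volume.restrict Ω) :=
    ⟨by simpa using hΩ.measure_lt_top⟩
  have h1 := (EuclideanSpace.proj (α, i) : Gr n N →L[ℝ] ℝ).comp_memLp' (hg.mono_exponent hp)
  have h2 := (EuclideanSpace.proj (α, i) : Gr n N →L[ℝ] ℝ).comp_memLp' (Lp.memLp (grad Ω n φ))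
  exact h1.integrable_mul h2

theorem isWeakSolution_iff (hΩ : Bornology.IsBounded Ω) (a : Tensor Ω n)
    {f : Fin n → Fin N → Sp N → Sp n → ℝ} {p : ℝ≥0∞} (hp : 2 ≤ p)
    (hf : ∀ v : CBar Ω n, MemLp (superpos f v) p (volume.restrict Ω)) (u : W0C Ω n) :
    IsWeakSolution a f u ↔
      ∀ φ, opA a (toW Ω n u) φ + pairD (opF f p hf (toC Ω n u)) φ = 0 := by
  refine forall_congr' fun φ => ?_
  have h1 : pairD (opF f p hf (toC Ω n u)) φ = ∫ x in Ω, ∑ α, ∑ i,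
      f α i x (ext0 (toC Ω n u) x) * grad Ω n φ x (α, i) := by
    refine integral_congr_ae ?_
    filter_upwards [(hf (toC Ω n u)).coeFn_toLp] with x hx
    simp only [opF, hx]
    rfl
  have hi : ∀ α i, Integrable (fun x => f α i x (ext0 (toC Ω n u) x) * grad Ω n φ x (α, i))
      (volume.restrict Ω) := integrable_mul_grad hΩ hp (hf (toC Ω n u)) φ
  -- The integral may be split because `p ≥ 2` on a bounded domain makes both products integrable.
  rw [h1, opA_eq_integral, ← integral_add]
  · simp only [add_mul, Finset.sum_add_distrib]
  · exact integrable_finsetSum _ fun α _ => integrable_finsetSum _ fun i _ =>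
      integrable_flux_mul_grad a _ φ α i
  · exact integrable_finsetSum _ fun α _ => integrable_finsetSum _ fun i _ => hi α i

theorem norm_le_supNorm (v : CBar Ω n) : ‖v‖ ≤ supNorm v := by
  have hb : ∀ α, BddAbove (range fun x => |v x α|) := fun α =>
    ⟨‖v‖, by rintro _ ⟨x, rfl⟩; exact (PiLp.norm_apply_le (v x) α).trans (v.norm_coe_le_norm x)⟩
  have h0 : 0 ≤ supNorm v := Finset.sum_nonneg fun α _ => Real.iSup_nonneg fun x => abs_nonneg _
  refine (BoundedContinuousFunction.norm_le h0).2 fun x => ?_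
  calc ‖v x‖ ≤ ∑ α, |v x α| := by
        rw [EuclideanSpace.norm_eq]
        refine Real.sqrt_le_iff.2 ⟨by positivity, ?_⟩
        simp only [Real.norm_eq_abs]
        exact Finset.sum_sq_le_sq_sum_of_nonneg fun α _ => abs_nonneg _
    _ ≤ supNorm v := Finset.sum_le_sum fun α _ => le_ciSup (hb α) x

theorem supNorm_le (v : CBar Ω n) : supNorm v ≤ n * ‖v‖ := by
  calc supNorm v ≤ ∑ _α : Fin n, ‖v‖ := Finset.sum_le_sum fun α _ =>
        Real.iSup_le (fun x => (PiLp.norm_apply_le (v x) α).trans (v.norm_coe_le_norm x))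
          (norm_nonneg _)
    _ = n * ‖v‖ := by simp

theorem supNorm_nonneg (v : CBar Ω n) : 0 ≤ supNorm v :=
  (norm_nonneg v).trans (norm_le_supNorm v)

end W0C

/-! ### Operators between Banach spaces -/

theorem exists_fixedPoint_closedBall {U : Type*} [NormedAddCommGroup U]
    [CompleteSpace U] {G : U → U} {x : U} {r : ℝ}
    (hr : 0 ≤ r)
    (hG : ∀ u v, ‖u - x‖ ≤ r → ‖v - x‖ ≤ r → ‖G u - G v‖ ≤ 1 / 2 * ‖u - v‖)
    (hx : ‖G x - x‖ ≤ r / 2) : ∃ u, ‖u - x‖ ≤ r ∧ G u = u ∧ ‖u - x‖ ≤ 2 * ‖G x - x‖ := by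
  have hx0 : ‖x - x‖ ≤ r := by simpa using hr
  have hmaps : MapsTo G (Metric.closedBall x r) (Metric.closedBall x r) := fun u hu => by
    rw [mem_closedBall_iff_norm] at hu ⊢
    have h1 := hG u x hu hx0
    have h2 := norm_sub_le_norm_sub_add_norm_sub (G u) (G x) x
    linarith
  have hcontr : ContractingWith (1 / 2) (hmaps.restrict G _ _) := by
    refine ⟨by rw [← NNReal.coe_lt_coe]; norm_num, LipschitzWith.of_dist_le_mul fun u v => ?_⟩
    have := hG u v (mem_closedBall_iff_norm.1 u.2) (mem_closedBall_iff_norm.1 v.2)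
    rw [Subtype.dist_eq, Subtype.dist_eq, dist_eq_norm, dist_eq_norm]
    simpa using this
  obtain ⟨u, hu, hfix, -⟩ := hcontr.exists_fixedPoint' Metric.isClosed_closedBall.isComplete hmaps
    (Metric.mem_closedBall_self hr) (edist_ne_top _ _)
  rw [mem_closedBall_iff_norm] at hu
  refine ⟨u, hu, hfix, ?_⟩
  have h1 := hG u x hu hx0
  have h2 := norm_sub_le_norm_sub_add_norm_sub (G u) (G x) x
  rw [hfix.eq] at h1 h2
  linarith

section Banach

variable {U V E L : Type*} [NormedAddCommGroup U] [NormedSpace ℝ U]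
  [NormedAddCommGroup V] [NormedSpace ℝ V]
  [NormedAddCommGroup E] [NormedSpace ℝ E] [NormedAddCommGroup L] [NormedSpace ℝ L]

theorem isInvertible_of_bijective [CompleteSpace U] [CompleteSpace V] {T : U →L[ℝ] V}
    (hT : Function.Bijective T) : T.IsInvertible :=
  ⟨ContinuousLinearEquiv.ofBijective T (LinearMap.ker_eq_bot.2 hT.1)
    (LinearMap.range_eq_top.2 hT.2), by ext; rfl⟩

/-- Fredholm alternative: `A + K = A (1 + A⁻¹ K)` with `A⁻¹ K` compact, so `-1` is either an
eigenvalue of `A⁻¹ K`, which injectivity excludes, or in the resolvent set. -/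
theorem bijective_add_of_isCompactOperator [CompleteSpace U] [CompleteSpace V] {A K : U →L[ℝ] V}
    (hA : Function.Bijective A) (hK : IsCompactOperator K) (hinj : Function.Injective (A + K)) :
    Function.Bijective (A + K) := by
  have hAi := isInvertible_of_bijective hA
  set S : U →L[ℝ] U := A.inverse ∘L K
  have hS : IsCompactOperator S := hK.clm_comp A.inverse
  have hAS : ∀ u, (A + K) u = A (u + S u) := fun u => by
    rw [map_add]
    change A u + K u = A u + A (A.inverse (K u))
    rw [hAi.self_apply_inverse]
  rcases hS.hasEigenvalue_or_mem_resolventSet (μ := (-1 : ℝ)) (by norm_num) with h | h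
  · obtain ⟨x, hx⟩ := h.exists_hasEigenvector
    have h1 : S x = -x := by simpa using hx.apply_eq_smul
    refine absurd (hinj ?_) hx.2
    rw [hAS, h1, add_neg_cancel, map_zero, map_zero]
  · have h2 : IsUnit (algebraMap ℝ (U →L[ℝ] U) (-1) - S) := h
    refine ⟨hinj, fun y => ?_⟩
    obtain ⟨R, hR⟩ := h2.exists_right_inv
    refine ⟨-R (A.inverse y), ?_⟩
    have h3 := DFunLike.congr_fun hR (A.inverse y)
    have h4 : -R (A.inverse y) - S (R (A.inverse y)) = A.inverse y := by
      simpa [Algebra.algebraMap_eq_smul_one] using h3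
    rw [hAS, map_neg S, ← sub_eq_add_neg, h4, hAi.self_apply_inverse]

theorem norm_inverse_le_of_lower_bound [CompleteSpace U] [CompleteSpace V] {T : U →L[ℝ] V}
    (hT : Function.Bijective T) {c : ℝ} (hc : 0 < c) (h : ∀ u, c * ‖u‖ ≤ ‖T u‖) :
    ‖T.inverse‖ ≤ c⁻¹ := by
  refine ContinuousLinearMap.opNorm_le_bound _ (by positivity) fun y => ?_
  have := h (T.inverse y)
  rw [(isInvertible_of_bijective hT).self_apply_inverse] at this
  rwa [inv_mul_eq_div, le_div_iff₀' hc]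

theorem IsCompactOperator.exists_tendsto_subseq {j : U →L[ℝ] E} (hj : IsCompactOperator j)
    {C : ℝ} {w : ℕ → U} (hw : ∀ k, ‖w k‖ ≤ C) :
    ∃ (v : E) (s : ℕ → ℕ), StrictMono s ∧ Tendsto (fun k => j (w (s k))) atTop (𝓝 v) := by
  obtain ⟨Q, hQ, hsub⟩ :=
    IsCompactOperator.image_closedBall_subset_compact (f := (j : U →ₗ[ℝ] E)) hj C
  obtain ⟨v, -, s, hs, h⟩ := hQ.tendsto_subseq (x := fun k => j (w k)) fun k =>
    hsub ⟨w k, by simpa using hw k, rfl⟩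
  exact ⟨v, s, hs, h⟩

/-- The Newton-type map `u ↦ u - T⁻¹ (A u + D F(j u))` with `T = A + D dF j` is Lipschitz with a
small constant where `F` is well approximated by `dF`. -/
theorem norm_newton_sub_le {A T : U →L[ℝ] V} {j : U →L[ℝ] E} {D : L →L[ℝ] V} {dF : E →L[ℝ] L}
    (hTA : T = A + D ∘L dF ∘L j) (hT : T.IsInvertible) {F : E → L} {s : Set E} {η : NNReal}
    (hF : ApproximatesLinearOn F dF s η) {C : ℝ} (hC : ‖T.inverse‖ ≤ C) {u v : U}
    (hu : j u ∈ s) (hv : j v ∈ s) :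
    ‖(u - T.inverse (A u + D (F (j u)))) - (v - T.inverse (A v + D (F (j v))))‖ ≤
      C * ‖D‖ * ‖j‖ * η * ‖u - v‖ := by
  have e : (u - T.inverse (A u + D (F (j u)))) - (v - T.inverse (A v + D (F (j v)))) =
      -T.inverse (D (F (j u) - F (j v) - dF (j u - j v))) := by
    have h1 : ∀ w, A w = T w - D (dF (j w)) := fun w => by simp [hTA]
    simp only [h1, map_sub, map_add, hT.inverse_apply_self]
    abel
  rw [e, norm_neg]
  have hC0 : 0 ≤ C := (norm_nonneg _).trans hC
  calc ‖T.inverse (D (F (j u) - F (j v) - dF (j u - j v)))‖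
      ≤ ‖T.inverse‖ * ‖D (F (j u) - F (j v) - dF (j u - j v))‖ := T.inverse.le_opNorm _
    _ ≤ C * (‖D‖ * (η * (‖j‖ * ‖u - v‖))) := by
        gcongr
        refine (D.le_opNorm _).trans ?_
        gcongr
        refine (hF _ hu _ hv).trans ?_
        gcongr
        rw [← map_sub]
        exact j.le_opNorm _
    _ = _ := by ring

/-- Newton-type iterations for a family of equations `A ε u + D (F (j u)) = 0` with uniformly
invertible linearizations `T ε = A ε + D dF j` have, near approximate solutions `ub ε`, unique fixed
points, and these are the only ones with `j u` close to `c₀`. -/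
theorem exists_newton_fixedPoints [CompleteSpace U] {A T : ℝ → U →L[ℝ] V} {j : U →L[ℝ] E}
    {D : L →L[ℝ] V} {F : E → L} {dF : E →L[ℝ] L} {c₀ : E} (hF : HasStrictFDerivAt F dF c₀)
    {ε₀ C : ℝ} (hε₀ : 0 < ε₀) (hC0 : 0 < C) (hTA : ∀ ε, T ε = A ε + D ∘L dF ∘L j)
    (hTi : ∀ ε ∈ Ioc 0 ε₀, (T ε).IsInvertible) (hTinv : ∀ ε ∈ Ioc 0 ε₀, ‖(T ε).inverse‖ ≤ C)
    {ub : ℝ → U} (hconv : Tendsto (fun ε => j (ub ε)) (𝓝[>] 0) (𝓝 c₀)) {ρ : ℝ → V}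
    (hρ : ∀ ε, ρ ε = A ε (ub ε) + D (F (j (ub ε)))) (hρ0 : Tendsto ρ (𝓝[>] 0) (𝓝 0))
    {G : ℝ → U → U} (hG : ∀ ε u, G ε u = u - (T ε).inverse (A ε u + D (F (j u)))) :
    ∃ r₀ > 0, ∃ ε₁ ∈ Ioc 0 ε₀, ∃ δ > 0, ∃ uε : ℝ → U, ∀ ε ∈ Ioc 0 ε₁,
      (∀ u, (‖u - ub ε‖ ≤ r₀ ∧ G ε u = u) ↔ u = uε ε) ∧ ‖uε ε - ub ε‖ ≤ 2 * (C * ‖ρ ε‖) ∧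
      ∀ u v, ‖j u - c₀‖ < δ → ‖j v - c₀‖ < δ → G ε u = u → G ε v = v → u = v := by
  -- Chosen so that the Lipschitz constant `C ‖D‖ ‖j‖ η` of the Newton map is at most 1/2; the
  -- summand 1 avoids division by zero.
  let η : NNReal := ⟨1 / (2 * (C * ‖D‖ * ‖j‖ + 1)), by positivity⟩
  have hηpos : 0 < η := by
    rw [← NNReal.coe_pos]
    change 0 < 1 / (2 * (C * ‖D‖ * ‖j‖ + 1))
    positivity
  have hηle : C * ‖D‖ * ‖j‖ * η ≤ 1 / 2 := by
    change C * ‖D‖ * ‖j‖ * (1 / (2 * (C * ‖D‖ * ‖j‖ + 1))) ≤ 1 / 2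
    have : 0 ≤ C * ‖D‖ * ‖j‖ := by positivity
    rw [mul_one_div, div_le_div_iff₀ (by positivity) two_pos]
    linarith
  obtain ⟨s, hs, hFs⟩ := hF.approximates_deriv_on_nhds (Or.inr hηpos)
  obtain ⟨δ, hδ, hδs⟩ := Metric.mem_nhds_iff.1 hs
  have hcontr : ∀ ε ∈ Ioc 0 ε₀, ∀ u v, ‖j u - c₀‖ < δ → ‖j v - c₀‖ < δ →
      ‖G ε u - G ε v‖ ≤ 1 / 2 * ‖u - v‖ := fun ε hε u v hu hv => by
    rw [hG, hG]
    refine (norm_newton_sub_le (hTA ε) (hTi ε hε) hFs (hTinv ε hε)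
      (hδs (mem_ball_iff_norm.2 hu)) (hδs (mem_ball_iff_norm.2 hv))).trans ?_
    gcongr
  have huniq : ∀ ε ∈ Ioc 0 ε₀, ∀ u v, ‖j u - c₀‖ < δ → ‖j v - c₀‖ < δ → G ε u = u →
      G ε v = v → u = v := fun ε hε u v hu hv hu' hv' => by
    have := hcontr ε hε u v hu hv
    rw [hu', hv'] at this
    have h0 := norm_nonneg (u - v)
    exact sub_eq_zero.1 (norm_eq_zero.1 (by linarith))
  have hGub : ∀ ε ∈ Ioc 0 ε₀, ‖G ε (ub ε) - ub ε‖ ≤ C * ‖ρ ε‖ := fun ε hε => by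
    have e : G ε (ub ε) - ub ε = -(T ε).inverse (ρ ε) := by
      rw [hG, hρ]
      abel
    rw [e, norm_neg]
    exact (ContinuousLinearMap.le_opNorm _ _).trans (by gcongr; exact hTinv ε hε)
  -- the fixed points
  set r₀ := δ / (2 * (‖j‖ + 1)) with hr₀
  have hr₀pos : 0 < r₀ := by positivity
  -- The `U`-ball of radius `r₀` maps under `j` into a ball of radius `δ / 2` about `j (ub ε)`,
  -- leaving `δ / 2` for the distance from `j (ub ε)` to `c₀`.
  have hjr : ‖j‖ * r₀ ≤ δ / 2 := by
    rw [hr₀, mul_div_assoc', div_le_div_iff₀ (by positivity) two_pos]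
    nlinarith [norm_nonneg j]
  have hev : ∀ᶠ ε in 𝓝[>] (0 : ℝ), ‖j (ub ε) - c₀‖ < δ / 2 ∧ C * ‖ρ ε‖ ≤ r₀ / 2 := by
    have h1 := (tendsto_iff_norm_sub_tendsto_zero.1 hconv).eventually_lt_const
      (show 0 < δ / 2 by positivity)
    have h2 := hρ0.norm.const_mul C
    rw [norm_zero, mul_zero] at h2
    filter_upwards [h1, h2.eventually_le_const (show 0 < r₀ / 2 by positivity)] with ε h3 h4
    exact ⟨h3, h4⟩
  obtain ⟨ε₁', hε₁', hsub⟩ := mem_nhdsGT_iff_exists_Ioc_subset.1 hev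
  set ε₁ := min ε₁' ε₀ with hε₁
  have hε₁pos : 0 < ε₁ := lt_min hε₁' hε₀
  have hle₁ : ∀ ε ∈ Ioc 0 ε₁, ε ∈ Ioc 0 ε₀ := fun ε hε =>
    ⟨hε.1, hε.2.trans (min_le_right _ _)⟩
  have hgood : ∀ ε ∈ Ioc 0 ε₁, ‖j (ub ε) - c₀‖ < δ / 2 ∧ C * ‖ρ ε‖ ≤ r₀ / 2 := fun ε hε =>
    hsub ⟨hε.1, hε.2.trans (min_le_left _ _)⟩
  have hball : ∀ ε ∈ Ioc 0 ε₁, ∀ u, ‖u - ub ε‖ ≤ r₀ → ‖j u - c₀‖ < δ := fun ε hε u hu => by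
    have h1 : ‖j u - j (ub ε)‖ ≤ ‖j‖ * r₀ := by
      rw [← map_sub]
      exact (j.le_opNorm _).trans (by gcongr)
    have h2 := norm_sub_le_norm_sub_add_norm_sub (j u) (j (ub ε)) c₀
    linarith [(hgood ε hε).1]
  have hex : ∀ ε, ∃ u, ε ∈ Ioc 0 ε₁ →
      ‖u - ub ε‖ ≤ r₀ ∧ G ε u = u ∧ ‖u - ub ε‖ ≤ 2 * (C * ‖ρ ε‖) := fun ε => by
    by_cases hε : ε ∈ Ioc 0 ε₁
    · have h1 := hGub ε (hle₁ ε hε)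
      obtain ⟨u, hu1, hu2, hu3⟩ := exists_fixedPoint_closedBall (G := G ε) hr₀pos.le
        (fun u v hu hv => hcontr ε (hle₁ ε hε) u v (hball ε hε u hu) (hball ε hε v hv))
        (h1.trans (hgood ε hε).2)
      exact ⟨u, fun _ => ⟨hu1, hu2, hu3.trans (by gcongr)⟩⟩
    · exact ⟨0, fun h => absurd h hε⟩
  choose uε huε using hex
  refine ⟨r₀, hr₀pos, ε₁, ⟨hε₁pos, min_le_right _ _⟩, δ, hδ, uε, fun ε hε =>
    ⟨fun u => ⟨fun h => ?_, ?_⟩, (huε ε hε).2.2, huniq ε (hle₁ ε hε)⟩⟩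
  · exact huniq ε (hle₁ ε hε) u (uε ε) (hball ε hε u h.1) (hball ε hε _ (huε ε hε).1) h.2
      (huε ε hε).2.1
  · rintro rfl
    exact ⟨(huε ε hε).1, (huε ε hε).2.1⟩

end Banach

/-! ### Uniform invertibility of the linearizations and convergence of the approximate solutions -/

section Perturbation

variable {N n : ℕ} {Ω : Set (Sp N)} {a : ℝ → Tensor Ω n} {ahat : Tensor Ω n}
  {U V : Type*} [NormedAddCommGroup U] [NormedSpace ℝ U] [CompleteSpace U]
  [NormedAddCommGroup V] [NormedSpace ℝ V] [CompleteSpace V]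

/-- Argument by contradiction: compactness of `U → C` turns the lower-order term into a strongly
convergent one, and H-convergence passes to the limit in the principal part. -/
theorem exists_lower_bound_linearization (hΩ : Bornology.IsBounded Ω)
    (ha_bdd : ∃ M : ℝ, ∀ ε > 0, ∀ α β i j, ‖a ε α β i j‖ ≤ M)
    (ha_leg : ∃ c > 0, ∀ ε > 0, IsLegendre c (a ε)) (ha_H : HConverges a ahat)
    {ι : U →L[ℝ] W0C Ω n} (hι_cpt : IsCompactOperator (toC Ω n ∘L ι))
    {κ : V →L[ℝ] Wneg Ω n} {A : ℝ → U →L[ℝ] V}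
    (hA : ∀ ε > 0, ∀ u, κ (A ε u) = opA (a ε) (toW Ω n (ι u)))
    (hA_bij : ∀ ε > 0, Function.Bijective (A ε))
    (hA_inv : ∃ C : ℝ, ∀ ε > 0, ‖(A ε).inverse‖ ≤ C)
    {K : CBar Ω n →L[ℝ] V}
    (hK : ∀ z : W0C Ω n, opA ahat (toW Ω n z) + κ (K (toC Ω n z)) = 0 → z = 0) :
    ∃ c > 0, ∃ ε₀ > 0, ∀ ε ∈ Ioc 0 ε₀, ∀ u,
      c * ‖u‖ ≤ ‖(A ε + K ∘L toC Ω n ∘L ι) u‖ := by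
  by_contra! hcon
  have hpos : ∀ k : ℕ, (0 : ℝ) < 1 / ((k : ℝ) + 1) := fun k => by positivity
  choose e he u hu using fun k : ℕ => hcon _ (hpos k) _ (hpos k)
  obtain ⟨C, hC⟩ := hA_inv
  have hu0 : ∀ k, 0 < ‖u k‖ := fun k => by
    refine lt_of_le_of_ne (norm_nonneg _) fun h => ?_
    have := hu k
    rw [← h, mul_zero] at this
    exact absurd this (not_lt.2 (norm_nonneg _))
  set w : ℕ → U := fun k => ‖u k‖⁻¹ • u k
  have hw1 : ∀ k, ‖w k‖ = 1 := fun k => by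
    simp only [w, norm_smul, norm_inv, norm_norm]
    exact inv_mul_cancel₀ (hu0 k).ne'
  have hTw : Tendsto (fun k => (A (e k) + K ∘L toC Ω n ∘L ι) (w k)) atTop (𝓝 0) := by
    refine squeeze_zero_norm (fun k => ?_) tendsto_one_div_add_atTop_nhds_zero_nat
    simp only [w, map_smul, norm_smul, norm_inv, norm_norm]
    rw [inv_mul_le_iff₀ (hu0 k), mul_comm]
    exact (hu k).le
  have he0 : Tendsto e atTop (𝓝[>] 0) := by
    refine tendsto_nhdsWithin_iff.2 ⟨?_, Eventually.of_forall fun k => (he k).1⟩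
    exact squeeze_zero (fun k => (he k).1.le) (fun k => (he k).2)
      tendsto_one_div_add_atTop_nhds_zero_nat
  obtain ⟨v, s, hs, hv⟩ := IsCompactOperator.exists_tendsto_subseq hι_cpt fun k => (hw1 k).le
  -- `A w = T w - K (j w)`, where `T w → 0` and `j w → v` along the subsequence.
  have hAw : Tendsto (fun k => A (e (s k)) (w (s k))) atTop (𝓝 (-K v)) := by
    have h1 := (hTw.comp hs.tendsto_atTop).sub ((K.continuous.tendsto v).comp hv)
    rw [zero_sub] at h1
    refine h1.congr fun k => ?_
    simp
  obtain ⟨z, hz, hz'⟩ := ha_H.exists_W0C_limit hΩ ha_bdd ha_leg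
    (he0.comp hs.tendsto_atTop) (w := fun k => ι (w (s k))) hv (φ := κ (-K v))
    (((κ.continuous.tendsto _).comp hAw).congr fun k => hA _ (he _).1 _)
  have hv0 : v = 0 := by
    rw [← hz, hK z (by rw [hz', hz, map_neg, neg_add_cancel]), map_zero]
  rw [hv0, map_zero, neg_zero] at hAw
  -- Now `A w → 0`, whereas `‖w‖ = 1` and the uniform bound on the inverses keep `A w` away from
  -- zero.
  have hle : ∀ k, 1 ≤ C * ‖A (e (s k)) (w (s k))‖ := fun k => by
    calc 1 = ‖(A (e (s k))).inverse (A (e (s k)) (w (s k)))‖ := by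
          rw [(isInvertible_of_bijective (hA_bij _ (he _).1)).inverse_apply_self, hw1]
      _ ≤ ‖(A (e (s k))).inverse‖ * ‖A (e (s k)) (w (s k))‖ := ContinuousLinearMap.le_opNorm _ _
      _ ≤ _ := by gcongr; exact hC _ (he _).1
  have hlim := hAw.norm.const_mul C
  rw [norm_zero, mul_zero] at hlim
  exact absurd (ge_of_tendsto' hlim hle) (by norm_num)

theorem tendsto_solution_sup (hΩ : IsOpen Ω) (hΩb : Bornology.IsBounded Ω)
    (ha_bdd : ∃ M : ℝ, ∀ ε > 0, ∀ α β i j, ‖a ε α β i j‖ ≤ M)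
    (ha_leg : ∃ c > 0, ∀ ε > 0, IsLegendre c (a ε)) (ha_H : HConverges a ahat)
    {ι : U →L[ℝ] W0C Ω n} (hι_cpt : IsCompactOperator (toC Ω n ∘L ι))
    {κ : V →L[ℝ] Wneg Ω n} {A : ℝ → U →L[ℝ] V}
    (hA : ∀ ε > 0, ∀ u, κ (A ε u) = opA (a ε) (toW Ω n (ι u)))
    (hA_bij : ∀ ε > 0, Function.Bijective (A ε))
    (hA_inv : ∃ C : ℝ, ∀ ε > 0, ‖(A ε).inverse‖ ≤ C)
    {g : V} {u₀ : W0C Ω n} (hu₀ : opA ahat (toW Ω n u₀) = κ g) :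
    Tendsto (fun ε => toC Ω n (ι ((A ε).inverse g))) (𝓝[>] 0) (𝓝 (toC Ω n u₀)) := by
  obtain ⟨C, hC⟩ := hA_inv
  refine tendsto_of_subseq_tendsto fun e he => ?_
  have hpos : ∀ᶠ k in atTop, 0 < e k := he self_mem_nhdsWithin
  -- The sequence is positive only eventually; shifting by `k₀` makes the bounds valid for every
  -- index.
  obtain ⟨k₀, hk₀⟩ := eventually_atTop.1 hpos
  have hpos' : ∀ k, 0 < e (k + k₀) := fun k => hk₀ _ (Nat.le_add_left _ _)
  obtain ⟨v, s, hs, hv⟩ := IsCompactOperator.exists_tendsto_subseq hι_cpt (C := C * ‖g‖)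
    (w := fun k => (A (e (k + k₀))).inverse g) fun k =>
      (ContinuousLinearMap.le_opNorm _ _).trans (by gcongr; exact hC _ (hpos' k))
  have he' : Tendsto (fun k => e (s k + k₀)) atTop (𝓝[>] 0) :=
    he.comp ((tendsto_add_atTop_nat k₀).comp hs.tendsto_atTop)
  obtain ⟨z, hz, hz'⟩ := ha_H.exists_W0C_limit hΩb ha_bdd ha_leg he'
    (w := fun k => ι ((A (e (s k + k₀))).inverse g)) hv (φ := κ g)
    (tendsto_const_nhds.congr fun k => by
      rw [← hA _ (hpos' _), (isInvertible_of_bijective (hA_bij _ (hpos' _))).self_apply_inverse])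
  -- Injectivity of `Â` makes the limit independent of the subsequence.
  have hzu : z = u₀ := toW_injective hΩ
    (ha_H.injective hΩb ha_bdd ha_leg (hz'.trans hu₀.symm))
  refine ⟨fun k => s k + k₀, ?_⟩
  rw [← hzu, hz]
  exact hv

theorem isWeakSolution_iff_opA_eq {V : Type*} [NormedAddCommGroup V] [NormedSpace ℝ V]
    (hΩ : Bornology.IsBounded Ω) (b : Tensor Ω n)
    {f : Fin n → Fin N → Sp N → Sp n → ℝ} {p : ℝ≥0∞} [Fact (1 ≤ p)] (hp : 2 ≤ p)
    (hf : ∀ v : CBar Ω n, MemLp (superpos f v) p (volume.restrict Ω))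
    {κ : V →L[ℝ] Wneg Ω n} {D : LpGr Ω n p →L[ℝ] V} (hD : ∀ g φ, κ (D g) φ = pairD g φ)
    (u : W0C Ω n) :
    IsWeakSolution b f u ↔ opA b (toW Ω n u) = κ (-D (opF f p hf (toC Ω n u))) := by
  rw [isWeakSolution_iff hΩ b hp hf, map_neg, eq_neg_iff_add_eq_zero, ContinuousLinearMap.ext_iff]
  refine forall_congr' fun φ => ?_
  rw [← hD]
  rfl

end Perturbation

end Homog

/-! ### The main theorem -/

open Homog

set_option maxHeartbeats 4000000 in
theorem mainTheorem2 {N n : ℕ} {Ω : Set (Sp N)} (hΩ : IsBoundedLipschitzDomain Ω)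
    -- the diffusion tensors and their H-limit
    (a : ℝ → Tensor Ω n) (ahat : Tensor Ω n)
    (ha_bdd : ∃ M : ℝ, ∀ ε > 0, ∀ α β i j, ‖a ε α β i j‖ ≤ M)
    (ha_leg : ∃ c > 0, ∀ ε > 0, IsLegendre c (a ε))
    (ha_H : HConverges a ahat)
    -- the nonlinearity
    (f : Fin n → Fin N → Sp N → Sp n → ℝ) (p₀ : ℝ≥0∞) [Fact (1 ≤ p₀)]
    (hp₀ : 2 ≤ p₀) (hNp₀ : (N : ℝ≥0∞) < p₀)
    (hf : ∀ v : CBar Ω n, MemLp (superpos f v) p₀ (volume.restrict Ω))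
    (hF : ContDiff ℝ 1 (opF f p₀ hf))
    -- the nondegenerate weak solution of the homogenized problem
    (u₀ : W0C Ω n) (hu₀ : IsWeakSolution ahat f u₀)
    (hu₀_nondeg : ∀ u : W0C Ω n,
      (∀ φ : W012 Ω n, opA ahat (toW Ω n u) φ +
        pairD (fderiv ℝ (opF f p₀ hf) (toC Ω n u₀) (toC Ω n u)) φ = 0) → u = 0)
    -- the Banach spaces `U` and `V` with their embeddings `ι` and `κ`
    {U V : Type*} [NormedAddCommGroup U] [NormedSpace ℝ U] [CompleteSpace U]
    [NormedAddCommGroup V] [NormedSpace ℝ V] [CompleteSpace V]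
    (ι : U →L[ℝ] W0C Ω n) (hι : Function.Injective ι)
    (hι_cpt : IsCompactOperator (toC Ω n ∘L ι))
    (κ : V →L[ℝ] Wneg Ω n) (hκ : Function.Injective κ)
    -- the operators `Â`, `A_ε` and `D` as bounded operators into `V`
    (hAhat : ∃ B : U →L[ℝ] V, ∀ u, κ (B u) = opA ahat (toW Ω n (ι u)))
    (A : ℝ → U →L[ℝ] V) (hA : ∀ ε > 0, ∀ u, κ (A ε u) = opA (a ε) (toW Ω n (ι u)))
    (D : LpGr Ω n p₀ →L[ℝ] V) (hD : ∀ g φ, κ (D g) φ = pairD g φ)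
    (hA_bij : ∀ ε > 0, Function.Bijective (A ε))
    (hA_inv : ∃ C : ℝ, ∀ ε > 0, ‖(A ε).inverse‖ ≤ C) :
    ∃ ε₀ > 0,
      -- `A_ε + D F'(u₀)` has an inverse, so that `G_ε` is defined, bounded uniformly in `ε`
      (∀ ε ∈ Ioc 0 ε₀, Function.Bijective
        (linOp (A ε) D (fderiv ℝ (opF f p₀ hf) (toC Ω n u₀)) (toC Ω n ∘L ι))) ∧
      (∃ C : ℝ, ∀ ε ∈ Ioc 0 ε₀,
        ‖(linOp (A ε) D (fderiv ℝ (opF f p₀ hf) (toC Ω n u₀)) (toC Ω n ∘L ι)).inverse‖ ≤ C) ∧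
      ∃ r₀ > 0, ∃ ε₁ ∈ Ioc 0 ε₀, ∃ uε : ℝ → U,
        -- `uε ε` is the unique fixed point of `G_ε` in the closed ball of radius `r₀`
        (∀ ε ∈ Ioc 0 ε₁, ∀ u : U,
          (‖u - approxSol (A ε) D (opF f p₀ hf) (toC Ω n u₀)‖ ≤ r₀ ∧
            fixMap (A ε) D (opF f p₀ hf) (toC Ω n u₀) (toC Ω n ∘L ι) u = u) ↔ u = uε ε) ∧
        -- the error estimate
        ((fun ε => supNorm (toC Ω n (ι (uε ε)) - toC Ω n u₀)) =O[𝓝[>] 0] fun ε =>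
          supNorm (toC Ω n (ι (approxSol (A ε) D (opF f p₀ hf) (toC Ω n u₀))) - toC Ω n u₀) +
          ‖A ε (approxSol (A ε) D (opF f p₀ hf) (toC Ω n u₀)) +
            D (opF f p₀ hf (toC Ω n (ι (approxSol (A ε) D (opF f p₀ hf) (toC Ω n u₀)))))‖) ∧
        -- local uniqueness with respect to the maximum norm
        ∃ δ > 0, ∃ ε₂ ∈ Ioc 0 ε₁, ∀ ε ∈ Ioc 0 ε₂,
          (∀ u : U, (supNorm (toC Ω n (ι u) - toC Ω n u₀) < δ ∧
            fixMap (A ε) D (opF f p₀ hf) (toC Ω n u₀) (toC Ω n ∘L ι) u = u) ↔ u = uε ε) ∧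
          (∀ u : W0C Ω n, (supNorm (toC Ω n u - toC Ω n u₀) < δ ∧
            IsWeakSolution (a ε) f u) ↔ u = ι (uε ε)) := by
  have hΩb := hΩ.isBounded
  set F := opF f p₀ hf
  set c₀ := toC Ω n u₀
  set dF := fderiv ℝ F c₀
  set j : U →L[ℝ] CBar Ω n := toC Ω n ∘L ι
  have hAi : ∀ ε > 0, (A ε).IsInvertible := fun ε hε => isInvertible_of_bijective (hA_bij ε hε)
  obtain ⟨co, hco, hcoer⟩ := exists_coercive_opA_of_HConverges hΩb ha_leg ha_H
  -- the linearizations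
  obtain ⟨c, hc, ε₀, hε₀, hlow⟩ := exists_lower_bound_linearization hΩb ha_bdd ha_leg ha_H
    hι_cpt hA hA_bij hA_inv (K := D ∘L dF) fun z hz => hu₀_nondeg z fun φ =>
      (congrArg _ (hD _ φ).symm).trans (DFunLike.congr_fun hz φ)
  have hTbij : ∀ ε ∈ Ioc 0 ε₀, Function.Bijective (linOp (A ε) D dF j) := fun ε hε => by
    refine bijective_add_of_isCompactOperator (hA_bij ε hε.1) (hι_cpt.clm_comp (D ∘L dF)) ?_
    refine (injective_iff_map_eq_zero _).2 fun u hu => ?_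
    have : c * ‖u‖ ≤ 0 := (hlow ε hε u).trans_eq ((congrArg norm hu).trans norm_zero)
    exact norm_le_zero_iff.1 (nonpos_of_mul_nonpos_right this hc)
  have hTi : ∀ ε ∈ Ioc 0 ε₀, (linOp (A ε) D dF j).IsInvertible := fun ε hε =>
    isInvertible_of_bijective (hTbij ε hε)
  set C := c⁻¹
  have hC0 : 0 < C := inv_pos.2 hc
  have hTinv : ∀ ε ∈ Ioc 0 ε₀, ‖(linOp (A ε) D dF j).inverse‖ ≤ C := fun ε hε =>
    norm_inverse_le_of_lower_bound (hTbij ε hε) hc (hlow ε hε)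
  refine ⟨ε₀, hε₀, hTbij, ⟨C, hTinv⟩, ?_⟩
  have hstrict : HasStrictFDerivAt F dF c₀ := hF.contDiffAt.hasStrictFDerivAt (by simp)
  set G : ℝ → U → U := fun ε u => fixMap (A ε) D F c₀ j u
  -- Fixed points are exactly the solutions in `U`, since the inverse of the linearization is
  -- injective.
  have hfix : ∀ ε ∈ Ioc 0 ε₀, ∀ u, G ε u = u ↔ A ε u + D (F (j u)) = 0 := fun ε hε u => by
    change u - (linOp (A ε) D dF j).inverse (A ε u + D (F (j u))) = u ↔ _
    refine sub_eq_self.trans ⟨fun h => ?_, fun h => (congrArg _ h).trans (map_zero _)⟩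
    exact ((hTi ε hε).self_apply_inverse _).symm.trans ((congrArg _ h).trans (map_zero _))
  -- the approximate solutions
  set ub : ℝ → U := fun ε => approxSol (A ε) D F c₀ with hub
  have hAub : ∀ ε > 0, A ε (ub ε) = -D (F c₀) := fun ε hε =>
    (map_neg _ _).trans (congrArg _ ((hAi ε hε).self_apply_inverse _))
  have hconv : Tendsto (fun ε => j (ub ε)) (𝓝[>] 0) (𝓝 c₀) := by
    have hg : opA ahat (toW Ω n u₀) = κ (-D (F c₀)) :=
      (isWeakSolution_iff_opA_eq hΩb ahat hp₀ hf hD u₀).1 hu₀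
    refine (tendsto_solution_sup hΩ.isOpen hΩb ha_bdd ha_leg ha_H hι_cpt hA hA_bij hA_inv
      hg).congr fun ε => ?_
    simp only [hub, approxSol, map_neg]
    rfl
  set ρ : ℝ → V := fun ε => A ε (ub ε) + D (F (j (ub ε))) with hρ
  have hρ0 : Tendsto ρ (𝓝[>] 0) (𝓝 0) := by
    have h1 : Tendsto (fun ε => -D (F c₀) + D (F (j (ub ε)))) (𝓝[>] 0)
        (𝓝 (-D (F c₀) + D (F c₀))) :=
      tendsto_const_nhds.add ((D.continuous.tendsto _).comp ((hF.continuous.tendsto _).comp hconv))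
    rw [neg_add_cancel] at h1
    refine h1.congr' ?_
    filter_upwards [self_mem_nhdsWithin] with ε hε
    simp only [hρ, hAub ε hε]
  obtain ⟨r₀, hr₀, ε₁, hε₁, δ, hδ, uε, huε⟩ := exists_newton_fixedPoints hstrict hε₀ hC0
    (fun _ => rfl) hTi hTinv hconv (fun _ => rfl) hρ0 (G := G) fun _ _ => rfl
  have hle₁ : ∀ ε ∈ Ioc 0 ε₁, ε ∈ Ioc 0 ε₀ := fun ε hε => ⟨hε.1, hε.2.trans hε₁.2⟩
  have hGu : ∀ ε ∈ Ioc 0 ε₁, G ε (uε ε) = uε ε := fun ε hε =>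
    (((huε ε hε).1 (uε ε)).2 rfl).2
  have hIoc : ∀ᶠ ε in 𝓝[>] (0 : ℝ), ε ∈ Ioc 0 ε₁ := Ioc_mem_nhdsGT hε₁.1
  -- The factor `n` compares `supNorm` with the norm of `C`; `2 C ‖j‖` comes from the bound `2 C ‖ρ
  -- ε‖` on the distance of the fixed point from `ub ε`.
  set M : ℝ := n * (2 * C * ‖j‖ + 1) with hM
  have herr : ∀ ε ∈ Ioc 0 ε₁, supNorm (j (uε ε) - c₀) ≤
      M * (supNorm (j (ub ε) - c₀) + ‖ρ ε‖) := fun ε hε => by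
    have h1 : ‖j (uε ε) - j (ub ε)‖ ≤ ‖j‖ * (2 * (C * ‖ρ ε‖)) :=
      (congrArg norm (map_sub j _ _)).symm.trans_le
        ((j.le_opNorm _).trans (by gcongr; exact (huε ε hε).2.1))
    have h2 := norm_sub_le_norm_sub_add_norm_sub (j (uε ε)) (j (ub ε)) c₀
    have h3 := norm_le_supNorm (j (ub ε) - c₀)
    have h4 : ‖j (uε ε) - c₀‖ ≤
        (2 * C * ‖j‖ + 1) * (supNorm (j (ub ε) - c₀) + ‖ρ ε‖) := by
      have h5 : 0 ≤ 2 * C * ‖j‖ * supNorm (j (ub ε) - c₀) :=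
        mul_nonneg (by positivity) (supNorm_nonneg _)
      nlinarith [norm_nonneg (ρ ε)]
    calc supNorm (j (uε ε) - c₀) ≤ n * ‖j (uε ε) - c₀‖ := supNorm_le _
      _ ≤ n * ((2 * C * ‖j‖ + 1) * (supNorm (j (ub ε) - c₀) + ‖ρ ε‖)) := by gcongr
      _ = _ := by rw [hM]; ring
  refine ⟨r₀, hr₀, ε₁, hε₁, uε, fun ε hε => (huε ε hε).1, ?_, ?_⟩
  · refine Asymptotics.IsBigO.of_bound M ?_
    filter_upwards [hIoc] with ε hε
    rw [Real.norm_of_nonneg (supNorm_nonneg _),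
      Real.norm_of_nonneg (add_nonneg (supNorm_nonneg _) (norm_nonneg _))]
    exact herr ε hε
  -- local uniqueness
  have hsup0 : Tendsto (fun ε => M * (supNorm (j (ub ε) - c₀) + ‖ρ ε‖)) (𝓝[>] 0) (𝓝 0) := by
    have h1 := (tendsto_iff_norm_sub_tendsto_zero.1 hconv).const_mul (n : ℝ)
    rw [mul_zero] at h1
    have h2 : Tendsto (fun ε => supNorm (j (ub ε) - c₀)) (𝓝[>] 0) (𝓝 0) :=
      squeeze_zero (fun _ => supNorm_nonneg _) (fun _ => supNorm_le _) h1
    have h3 := (h2.add hρ0.norm).const_mul M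
    rwa [norm_zero, add_zero, mul_zero] at h3
  -- Below `ε₂'` the error estimate places `uε ε` itself in the `δ`-neighbourhood of `u₀`. The same
  -- `δ` works for `supNorm`, which dominates the norm of `C`.
  obtain ⟨ε₂', hε₂', hsub₂⟩ := mem_nhdsGT_iff_exists_Ioc_subset.1 (hsup0.eventually_lt_const hδ)
  refine ⟨δ, hδ, min ε₂' ε₁, ⟨lt_min hε₂' hε₁.1, min_le_right _ _⟩, fun ε hε => ?_⟩
  have hε1 : ε ∈ Ioc 0 ε₁ := ⟨hε.1, hε.2.trans (min_le_right _ _)⟩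
  have hε0 := hle₁ ε hε1
  have hclose : supNorm (j (uε ε) - c₀) < δ :=
    (herr ε hε1).trans_lt (hsub₂ ⟨hε.1, hε.2.trans (min_le_left _ _)⟩)
  have hmain : ∀ u : U, (supNorm (j u - c₀) < δ ∧ G ε u = u) ↔ u = uε ε := fun u => by
    constructor
    · rintro ⟨h1, h2⟩
      exact (huε ε hε1).2.2 u (uε ε) ((norm_le_supNorm _).trans_lt h1)
        ((norm_le_supNorm _).trans_lt hclose) h2 (hGu ε hε1)
    · rintro rfl
      exact ⟨hclose, hGu ε hε1⟩
  refine ⟨hmain, fun u => ?_⟩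
  rw [isWeakSolution_iff_opA_eq hΩb (a ε) hp₀ hf hD]
  constructor
  · rintro ⟨h1, h2⟩
    -- Regularity of weak solutions: `w ∈ U` solves `A_ε w = -D F(u)`, the equation satisfied by `u`
    -- in `W*`. Coercivity of `A_ε` on `W` then gives `ι w = u`.
    have hex : A ε (-(A ε).inverse (D (F (toC Ω n u)))) = -D (F (toC Ω n u)) :=
      (map_neg _ _).trans (congrArg _ ((hAi ε hε.1).self_apply_inverse _))
    set w := -(A ε).inverse (D (F (toC Ω n u)))
    have hw : ι w = u := by
      refine toW_injective hΩ.isOpen (coercive_injective hco (hcoer ε hε.1) ?_)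
      exact (hA ε hε.1 w).symm.trans ((congrArg κ hex).trans h2.symm)
    have hjw : j w = toC Ω n u := congrArg (toC Ω n) hw
    have hfw : A ε w + D (F (j w)) = 0 := by
      rw [hjw]
      exact (congrArg (· + D (F (toC Ω n u))) hex).trans (neg_add_cancel _)
    exact hw.symm.trans (congrArg ι ((hmain w).1 ⟨by rwa [hjw], (hfix ε hε0 w).2 hfw⟩))
  · rintro rfl
    have h0 := (hfix ε hε0 (uε ε)).1 (hGu ε hε1)
    exact ⟨hclose, (hA ε hε.1 _).symm.trans (congrArg κ (eq_neg_of_add_eq_zero_left h0))⟩
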